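/- Let $S=\mathbb H/PSL(2,\mathbb Z)$ be the modular orbifold, with generators $a,b$ of $PSL(2,\mathbb Z)\cong\mathbb Z_2*\mathbb Z_3$ given by $a=\pm\begin{pmatrix}0&-1\\1&0\end{pmatrix}$ and $b=\pm\begin{pmatrix}1&-1\\1&0\end{pmatrix}$. A (closed, oriented) geodesic $\gamma$ on $S$ is a conjugacy class of hyperbolic elements of $PSL(2,\mathbb Z)$; its word length $|\gamma|$ is the minimal length, in the letters $a,b,b^{-1}$, of an element of the class. It is primitive if its elements are not proper powers, and reciprocal if the axes of its elements pass through fixed points of elements of order two. The cusp of $S$ is the image of $\{\operatorname{Im} z\ge 1\}$, and the point of $S$ represented by $z$ with $\operatorname{Im}z\ge1$ has depth $\log\operatorname{Im} z$. For a positive integer $m$ the $m$-thick part $S_m$ is $S$ with the points of depth larger than $\log\frac{m+1}2$ deleted. A geodesic lies in $S_m$ if the projection of its axis to $S$ is contained in $S_m$. Let $R(t)$ and $R_m(t)$ be the numbers of primitive reciprocal geodesics $\gamma$ with $|\gamma|\le 2t$ on $S$ and in $S_m$, respectively, and let $W(t)$ and $W_m(t)$ be the corresponding numbers of all primitive closed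 geodesics. For a counting function $N$ let its lower and upper exponential growth rates be the $\liminf$ and $\limsup$ of $\frac1t\log N(t)$ as $t\to\infty$ (with $\log 0=-\infty$). Then the following hold. 1. $R(t)\sim 2^{\lfloor t/2\rfloor}$ as $t\to\infty$; in particular the lower and upper growth rates of $R$ both equal $\frac12\log 2$. The growth rate of $R_m$ converges to that of $R$ as $m\to\infty$: there are real sequences $c_m\to1$ and $\lambda_m\to 2$ such that for every $\varepsilon>0$ there is a $t_0$, independent of $m$, with $$(1-\varepsilon)\,c_m\lambda_m^{\lfloor t/2\rfloor}\le R_m(t)\le R(t)\qquad\text{for all } m\ge1,\ t\ge t_0;$$ and the lower and upper growth rates of $R_m$ converge, as $m\to\infty$, to those of $R$. 2. $W(t)\sim 2^{t+1}/t$ as $t\to\infty$; in particular the lower and upper growth rates of $W$ both equal $\log 2$. The growth rate of $W_m$ converges to that of $W$ up to a multiplicative constant as $m\to\infty$: there are a constant $C>0$, a real sequence $\lambda_m\to2$ and a $t_0$, with $C$ and $t_0$ independent of $m$, such that $$C\,\frac{\lambda_m^{t}}{t}\le W_m(t)\le W(t)\qquad\text{for all } m\ge1,\ t\ge t_0;$$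 and the lower and upper growth rates of $W_m$ converge, as $m\to\infty$, to those of $W$. -/

import Mathlib

open Filter Topology Asymptotics
open scoped MatrixGroups UpperHalfPlane ENNReal

noncomputable section

namespace ModularOrbifold

/-- The modular group `PSL(2, ℤ)`. -/
abbrev Gam : Type := PSL(2, ℤ)

/-- The modular orbifold `S = ℍ / PSL(2, ℤ)`. The group `SL(2, ℤ)` acts on `ℍ` through
`PSL(2, ℤ)`, so the two groups have the same orbits. -/
abbrev Orbifold : Type := MulAction.orbitRel.Quotient SL(2, ℤ) ℍ

/-- The projection `ℍ → S`. -/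
def proj (z : ℍ) : Orbifold := Quotient.mk _ z

/-- A lift of the generator of order two. -/
def matA : SL(2, ℤ) := ⟨!![0, -1; 1, 0], by simp⟩

/-- The generator of order two. -/
def genA : Gam := QuotientGroup.mk matA

/-- A lift of the generator of order three. -/
def matB : SL(2, ℤ) := ⟨!![1, -1; 1, 0], by simp⟩

/-- The generator of order three. -/
def genB : Gam := QuotientGroup.mk matB

/-- The word length of an element with respect to the generators `a, b, b⁻¹`: the least number of
letters of a word that represents it. -/
def wordLength (g : Gam) : ℕ :=
  sInf {n | ∃ l : List Gam, (∀ x ∈ l, x = genA ∨ x = genB ∨ x = genB⁻¹) ∧ l.prod = g ∧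
    l.length = n}

/-- The length of a conjugacy class: the least word length of its elements. -/
def classLength (c : ConjClasses Gam) : ℕ :=
  sInf {n | ∃ g : Gam, ConjClasses.mk g = c ∧ wordLength g = n}

/-- Hyperbolic elements: the absolute value of the trace (of either lift) exceeds `2`. -/
def IsHyperbolic (g : Gam) : Prop :=
  ∃ M : SL(2, ℤ), (QuotientGroup.mk M : Gam) = g ∧ 2 < |M.1.trace|

/-- The element is not a proper power of another element. (Powers with exponent `≤ -2` are
covered through inverses; the elements of interest are nontrivial.) -/
def IsPrimitive (g : Gam) : Prop := ∀ (h : Gam) (n : ℕ), 2 ≤ n → h ^ n ≠ g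

/-- The axis in `ℍ` of a hyperbolic element with lift `M = (a, b; c, d)`. The fixed points of `M`
on the real line are the two roots of `c x² + (d - a) x - b`, and the geodesic of `ℍ` that joins
them is the half circle `c |z|² + (d - a) Re z - b = 0`. -/
def axis (g : Gam) : Set ℍ :=
  {z | ∃ M : SL(2, ℤ), (QuotientGroup.mk M : Gam) = g ∧
    (M 1 0 : ℝ) * (z.re ^ 2 + z.im ^ 2) + ((M 1 1 : ℝ) - (M 0 0 : ℝ)) * z.re - (M 0 1 : ℝ) = 0}

/-- Closed (oriented) geodesics on `S` are given by the conjugacy classes of hyperbolic elements. -/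
def IsClosedGeodesic (c : ConjClasses Gam) : Prop :=
  ∃ g : Gam, ConjClasses.mk g = c ∧ IsHyperbolic g

/-- The set of points of `S` through which a closed geodesic passes: the projection of the axis of
a representative. -/
def carrier (c : ConjClasses Gam) : Set Orbifold :=
  {p | ∃ g : Gam, ConjClasses.mk g = c ∧ ∃ z ∈ axis g, proj z = p}

/-- Primitive closed geodesics. -/
def IsPrimitiveGeodesic (c : ConjClasses Gam) : Prop :=
  IsClosedGeodesic c ∧ ∃ g : Gam, ConjClasses.mk g = c ∧ IsPrimitive g

/-- Points of `ℍ` that are fixed by an element of order two. -/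
def IsOrderTwoPoint (z : ℍ) : Prop :=
  ∃ M : SL(2, ℤ), orderOf (QuotientGroup.mk M : Gam) = 2 ∧ M • z = z

/-- Reciprocal geodesics: classes of hyperbolic elements whose axis passes through a fixed point
of an element of order two. -/
def IsReciprocal (c : ConjClasses Gam) : Prop :=
  ∃ g : Gam, ConjClasses.mk g = c ∧ IsHyperbolic g ∧ ∃ z ∈ axis g, IsOrderTwoPoint z

/-- The `m`-thick part `S_m` (for `m ≥ 1`). The cusp is the image of `{Im z ≥ 1}`, its boundary
`Im z = 1` is the horocycle of length one, and a point `z` of the cusp has depth (hyperbolic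
distance to that horocycle) `log (Im z)`. The points of depth larger than `log ((m + 1) / 2)` are
deleted. -/
def thickPart (m : ℕ) : Set Orbifold :=
  {p | ∀ z : ℍ, proj z = p → 1 ≤ z.im → Real.log z.im ≤ Real.log (((m : ℝ) + 1) / 2)}

/-- Number of primitive closed geodesics of word length at most `2t`. -/
def closedCount (t : ℕ) : ℕ :=
  {c | IsPrimitiveGeodesic c ∧ classLength c ≤ 2 * t}.ncard

/-- Number of primitive closed geodesics in `S_m` of word length at most `2t`. -/
def closedCountThick (m t : ℕ) : ℕ :=
  {c | IsPrimitiveGeodesic c ∧ carrier c ⊆ thickPart m ∧ classLength c ≤ 2 * t}.ncard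

/-- Number of primitive reciprocal geodesics of word length at most `2t`. -/
def recipCount (t : ℕ) : ℕ :=
  {c | IsPrimitiveGeodesic c ∧ IsReciprocal c ∧ classLength c ≤ 2 * t}.ncard

/-- Number of primitive reciprocal geodesics in `S_m` of word length at most `2t`. -/
def recipCountThick (m t : ℕ) : ℕ :=
  {c | IsPrimitiveGeodesic c ∧ IsReciprocal c ∧ carrier c ⊆ thickPart m ∧
    classLength c ≤ 2 * t}.ncard

/-- The lower exponential growth rate `liminf (log (N t)) / t` of a counting function. -/
def lowerRate (N : ℕ → ℕ) : EReal := ExpGrowth.expGrowthInf (fun t => (N t : ℝ≥0∞))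

/-- The upper exponential growth rate `limsup (log (N t)) / t` of a counting function. -/
def upperRate (N : ℕ → ℕ) : EReal := ExpGrowth.expGrowthSup (fun t => (N t : ℝ≥0∞))

end ModularOrbifold

end

noncomputable section

namespace ModularOrbifold

/-! The matrices of `ba` and `b⁻¹a`, up to sign the unipotent matrices (1,1;0,1) and (1,0;1,1),
freely generate the monoid of nonnegative matrices in SL(2, ℤ) (`IsNonneg.exists_mat`,
`mat_injective`). Cyclic reduction in ℤ₂ * ℤ₃ brings every hyperbolic class to a word in these two
letters, and both letters occur. The word is unique up to rotation (`Mixed.cls_eq_iff`), because a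
conjugator between positive matrices becomes, up to sign, a nonnegative matrix after multiplication
by a high power (`exists_mat_eq_mul_pow`). Closed geodesics are thus binary necklaces with both
letters, and the length of the class is twice that of the word.

Primitive geodesics are primitive necklaces, of which there are about 2ⁿ/n of length n; summation
over n ≤ t gives 2^(t+1)/t. Inversion of the class corresponds to `dual`, which is transposition on
matrices. The necklace of a reciprocal geodesic contains a word x ++ dual x, and in the primitive
case exactly two such words. With |x| = k this gives about 2^(k-1) geodesics of class length 4k,
hence 2^⌊t/2⌋ in total.

An axis that rises above height (m+1)/2 has a diameter larger than m+1. Some translate of it has its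
endpoints on either side of [0, m], and then m equal letters occur in a row in the necklace or its
dual. So necklaces with cyclic runs at most m-1 stay in S_m (`CyclicRunsLE.carrier_subset`). The
number of words with runs at most r grows at least like λ^k as soon as (2-λ)λ^r ≥ 2
(`pow_le_card_runWords`), which allows λ = 2 - 1/r for r = m-1 ≥ 5. All error terms are compared
with powers of 9/5, a lower bound for all these λ, so the thresholds in t do not depend on m. -/

/-! ### Combinatorics of words -/

/-- The `k`-th power of a word. -/
def wordPow (z : List Bool) (k : ℕ) : List Bool := (List.replicate k z).flatten

@[simp] theorem wordPow_zero (z : List Bool) : wordPow z 0 = [] := rfl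

theorem wordPow_succ (z : List Bool) (k : ℕ) : wordPow z (k + 1) = z ++ wordPow z k := by
  simp [wordPow, List.replicate_succ]

theorem wordPow_add (z : List Bool) (j k : ℕ) :
    wordPow z (j + k) = wordPow z j ++ wordPow z k := by
  rw [wordPow, List.replicate_add, List.flatten_append]; rfl

@[simp] theorem wordPow_one (z : List Bool) : wordPow z 1 = z := by simp [wordPow]

@[simp] theorem length_wordPow (z : List Bool) (k : ℕ) :
    (wordPow z k).length = k * z.length := by
  simp [wordPow]

theorem wordPow_succ' (z : List Bool) (k : ℕ) : wordPow z (k + 1) = wordPow z k ++ z := by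
  rw [wordPow_add, wordPow_one]

/-- Commuting words are powers of a common word. -/
theorem exists_root_of_commute (u v : List Bool) (h : u ++ v = v ++ u) :
    ∃ z i j, u = wordPow z i ∧ v = wordPow z j := by
  induction hn : u.length + v.length using Nat.strong_induction_on generalizing u v with
  | _ n ih =>
    subst hn
    rcases List.eq_nil_or_concat' u with rfl | ⟨u', x, hu⟩
    · exact ⟨v, 0, 1, by simp, by simp⟩
    rcases List.eq_nil_or_concat' v with rfl | ⟨v', y, hv⟩
    · exact ⟨u, 1, 0, by simp, by simp⟩
    have hul : 0 < u.length := by simp [hu]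
    have hvl : 0 < v.length := by simp [hv]
    -- Euclid's algorithm on the lengths: the shorter word is a prefix of the longer one, and the
    -- remainder still commutes with it.
    rcases List.append_eq_append_iff.mp h with ⟨s, hs, hs'⟩ | ⟨s, hs, hs'⟩
    · have h1 : u ++ s = s ++ u := by rw [← hs, hs']
      obtain ⟨z, i, j, hi, hj⟩ := ih (u.length + s.length)
        (by have := congrArg List.length hs; simp at this; omega) u s h1 rfl
      exact ⟨z, i, i + j, hi, by rw [hs, wordPow_add, ← hi, ← hj]⟩
    · have h1 : s ++ v = v ++ s := by rw [← hs', hs]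
      obtain ⟨z, i, j, hi, hj⟩ := ih (s.length + v.length)
        (by have := congrArg List.length hs; simp at this; omega) s v h1 rfl
      exact ⟨z, j + i, j, by rw [hs, wordPow_add, ← hi, ← hj], hj⟩

/-- Words conjugate in the free monoid are rotations of each other. -/
theorem isRotated_of_conj (n p q : List Bool) (h : n ++ p = q ++ n) : p ~r q := by
  induction hl : n.length using Nat.strong_induction_on generalizing n with
  | _ k ih =>
    subst hl
    rcases List.append_eq_append_iff.mp h with ⟨s, hs, hs'⟩ | ⟨s, hs, hs'⟩
    · rw [hs, hs']
      exact List.isRotated_append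
    -- Here `q` is a prefix of `n`; after stripping it the remainder `s` satisfies the same
    -- equation.
    · by_cases hq : q = []
      · subst hq
        have : p = [] := by
          have := congrArg List.length h
          simp at this
          exact this
        rw [this]
      · refine ih s.length ?_ s ?_ rfl
        · have := congrArg List.length hs
          have h2 := List.length_pos_iff.mpr hq
          simp at this
          omega
        · rw [← hs', hs]

/-! ### Primitive words -/

/-- A word is primitive if it is nonempty and differs from its nontrivial rotations. -/
def PrimWord (w : List Bool) : Prop := w ≠ [] ∧ ∀ j, 0 < j → j < w.length → w.rotate j ≠ w

theorem PrimWord.rotate {w : List Bool} (h : PrimWord w) (k : ℕ) : PrimWord (w.rotate k) := by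
  refine ⟨by simpa using h.1, fun j hj hj' he => h.2 j hj (by simpa using hj') ?_⟩
  rw [List.rotate_rotate, add_comm, ← List.rotate_rotate] at he
  exact List.rotate_injective k he

theorem PrimWord.wordPow_ne {w : List Bool} (h : PrimWord w) (z : List Bool) (k : ℕ) (hk : 2 ≤ k) :
    wordPow z k ≠ w := by
  rintro rfl
  obtain ⟨k, rfl⟩ := Nat.exists_eq_add_of_le' hk
  have hz : 0 < z.length := by
    rw [List.length_pos_iff]
    rintro rfl
    exact h.1 (List.length_eq_zero_iff.mp (by simp))
  refine h.2 z.length hz ?_ ?_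
  · simp only [length_wordPow]; nlinarith
  · rw [show k + 2 = (k + 1) + 1 from rfl, wordPow_succ z (k + 1),
      List.rotate_append_length_eq, ← wordPow_succ' z (k + 1), wordPow_succ]

/-- If rotation by `j` fixes `w`, the first `j` letters commute with the remaining ones, so both
pieces are powers of one word. Neither piece is empty, so the exponents add up to at least two. -/
theorem exists_wordPow_of_not_primWord {w : List Bool} (hw : w ≠ []) (h : ¬ PrimWord w) :
    ∃ z k, 2 ≤ k ∧ wordPow z k = w := by
  simp only [PrimWord, not_and, not_forall, not_not] at h
  obtain ⟨j, hj, hj', he⟩ := h hw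
  rw [List.rotate_eq_drop_append_take hj'.le] at he
  obtain ⟨z, a, b, ha, hb⟩ := exists_root_of_commute (w.take j) (w.drop j)
    (by rw [he, List.take_append_drop])
  have ha0 : a ≠ 0 := by
    rintro rfl
    have := congrArg List.length ha
    simp [hw] at this
    omega
  have hb0 : b ≠ 0 := by
    rintro rfl
    have := congrArg List.length hb
    simp at this
    omega
  exact ⟨z, a + b, by omega, by rw [wordPow_add, ← ha, ← hb, List.take_append_drop]⟩

theorem PrimWord.rotate_eq_iff {w : List Bool} (h : PrimWord w) (j : ℕ) :
    w.rotate j = w ↔ w.length ∣ j := by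
  constructor
  · intro he
    rw [← List.rotate_mod] at he
    by_contra hd
    exact h.2 _ (Nat.pos_of_ne_zero fun h0 => hd (Nat.dvd_of_mod_eq_zero h0))
      (Nat.mod_lt _ (List.length_pos_iff.mpr h.1)) he
  · rintro ⟨k, rfl⟩
    exact List.rotate_length_mul _ _

/-! ### Duality and self-dual words -/

/-- Reversal of a word combined with the exchange of the two letters. -/
def dual (w : List Bool) : List Bool := (w.map not).reverse

@[simp] theorem dual_dual (w : List Bool) : dual (dual w) = w := by
  simp [dual, Function.comp_def]

@[simp] theorem dual_append (u v : List Bool) : dual (u ++ v) = dual v ++ dual u := by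
  simp [dual]

@[simp] theorem length_dual (w : List Bool) : (dual w).length = w.length := by simp [dual]

theorem dual_rotate (w : List Bool) (j : ℕ) :
    dual (w.rotate j) = (dual w).rotate (w.length - j % w.length) := by
  rw [dual, List.map_rotate, List.reverse_rotate, dual]
  simp

theorem dual_wordPow (z : List Bool) (k : ℕ) : dual (wordPow z k) = wordPow (dual z) k := by
  induction k with
  | zero => rfl
  | succ k ih => rw [wordPow_succ, dual_append, ih, ← wordPow_succ']

/-- A word fixed by `dual` has the form `x ++ dual x`. -/
theorem exists_eq_append_dual {w : List Bool} (h : dual w = w) : ∃ x, w = x ++ dual x := by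
  obtain ⟨k, hk | hk⟩ := Nat.even_or_odd' w.length
  · refine ⟨w.take k, ?_⟩
    have h1 : dual (w.drop k) ++ dual (w.take k) = w.take k ++ w.drop k := by
      rw [← dual_append, List.take_append_drop, h]
    have h2 := (List.append_inj h1 (by simp; omega)).2
    rw [h2, List.take_append_drop]
  -- In odd length the middle letter would equal its own negation.
  · exfalso
    have h1 : (dual w)[k]? = w[k]? := by rw [h]
    have hk' : k < w.length := by omega
    rw [dual, List.getElem?_reverse (by simpa using hk')] at h1
    simp only [List.length_map, List.getElem?_map] at h1
    rw [show w.length - 1 - k = k by omega, List.getElem?_eq_getElem hk'] at h1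
    simp at h1

theorem dual_append_dual (x : List Bool) : dual (x ++ dual x) = x ++ dual x := by simp

/-- The rotations fixed by `dual` of a primitive word fixed by `dual`. -/
theorem PrimWord.dual_rotate_eq_iff {w : List Bool} (h : PrimWord w) (hs : dual w = w) (j : ℕ) :
    dual (w.rotate j) = w.rotate j ↔ w.length ∣ 2 * j := by
  have hl := List.length_pos_iff.mpr h.1
  have hlt := Nat.mod_lt j hl
  rw [dual_rotate, hs, ← List.rotate_mod w j]
  -- `dual` turns rotation by `j` into rotation by `-j`, so the condition says that rotation by `2 *
  -- j` fixes `w`.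
  have key : w.rotate (w.length - j % w.length) = w.rotate (j % w.length) ↔
      w.rotate (j % w.length + j % w.length) = w := by
    rw [← (List.rotate_injective (j % w.length)).eq_iff]
    simp only [List.rotate_rotate]
    rw [Nat.sub_add_cancel hlt.le, List.rotate_length, eq_comm]
  rw [key, h.rotate_eq_iff, ← two_mul, Nat.dvd_iff_mod_eq_zero, Nat.dvd_iff_mod_eq_zero,
    Nat.mul_mod, Nat.mod_mod, ← Nat.mul_mod]

/-- If the words `w` and `dual w` are rotations of each other, some rotation of `w` is fixed by
`dual`. -/
theorem exists_dual_eq_of_isRotated {w : List Bool} (h : w ~r dual w) :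
    ∃ w', w ~r w' ∧ dual w' = w' := by
  obtain ⟨j, hj, he⟩ := List.isRotated_iff_mod.mp h
  rw [List.rotate_eq_drop_append_take hj] at he
  set u := w.take j with hu
  set v := w.drop j with hv
  have hw : w = u ++ v := (List.take_append_drop j w).symm
  have h1 : v ++ u = dual v ++ dual u := by rw [he, hw, dual_append]
  obtain ⟨h2, h3⟩ := List.append_inj h1 (by simp)
  obtain ⟨x, hx⟩ := exists_eq_append_dual h2.symm
  obtain ⟨y, hy⟩ := exists_eq_append_dual h3.symm
  -- Both pieces are self-dual, so `w` is `x x* y y*` with `*` for `dual`; read cyclically from `y*`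
  -- on it is `y* x x* y`, which is its own dual.
  refine ⟨dual y ++ x ++ (dual x ++ y), ?_, by simp⟩
  rw [hw, hx, hy]
  have := List.isRotated_append (l := y) (l' := dual y ++ (x ++ dual x))
  simpa using this

/-! ### Words with bounded runs -/

/-- All runs of equal letters in the word have length at most `r`. -/
def RunsLE (r : ℕ) (w : List Bool) : Prop := ∀ b, ¬ List.replicate (r + 1) b <:+: w

/-- All cyclic runs of equal letters in the word have length at most `r`. -/
def CyclicRunsLE (r : ℕ) (w : List Bool) : Prop := RunsLE r (w ++ w)

theorem RunsLE.of_infix {r : ℕ} {u w : List Bool} (h : RunsLE r w) (hu : u <:+: w) : RunsLE r u :=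
  fun b hb => h b (hb.trans hu)

theorem rotate_infix_append_self (w : List Bool) (j : ℕ) : w.rotate j <:+: w ++ w := by
  rw [← List.rotate_mod]
  rcases Nat.eq_zero_or_pos w.length with h0 | h0
  · rw [List.length_eq_zero_iff.mp h0]; simp
  rw [List.rotate_eq_drop_append_take (Nat.mod_lt _ h0).le]
  refine ⟨w.take (j % w.length), w.drop (j % w.length), ?_⟩
  simp only [List.append_assoc, List.take_append_drop]
  rw [← List.append_assoc, List.take_append_drop]

theorem CyclicRunsLE.runsLE_of_isRotated {r : ℕ} {w w' : List Bool} (h : CyclicRunsLE r w)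
    (hw : w ~r w') : RunsLE r w' := by
  obtain ⟨j, rfl⟩ := hw
  exact h.of_infix (rotate_infix_append_self w j)

/-- A run across the junction would contain the last letter of `u` and the first one of `v`, and
these differ. -/
theorem RunsLE.append {r : ℕ} {u v : List Bool} (hu : RunsLE r u) (hv : RunsLE r v)
    (h : ∀ b ∈ u.getLast?, b ∉ v.head?) : RunsLE r (u ++ v) := by
  intro b hb
  rcases List.infix_append_iff_ne_nil.mp hb with hb | hb | ⟨l₁, l₂, h1, h2, h3, h4, h5⟩
  · exact hu b hb
  · exact hv b hb
  · have hl : ∀ x ∈ l₁ ++ l₂, x = b := by rw [← h3]; simp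
    obtain ⟨s, rfl⟩ := h4
    obtain ⟨t, rfl⟩ := h5
    obtain ⟨l₁, x, rfl⟩ := (List.eq_nil_or_concat' l₁).resolve_left h1
    obtain ⟨y, l₂, rfl⟩ := List.exists_cons_of_ne_nil h2
    have hx := hl x (by simp)
    have hy := hl y (by simp)
    refine h x ?_ ?_
    · rw [← List.append_assoc]; simp
    · simp [hx, hy]

theorem RunsLE.runsLE_dual {r : ℕ} {w : List Bool} (h : RunsLE r w) : RunsLE r (dual w) := by
  rintro b ⟨s, t, hst⟩
  refine h (!b) ⟨dual t, dual s, ?_⟩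
  have := congrArg dual hst
  rw [dual_dual] at this
  rw [← this]
  simp [dual]

theorem CyclicRunsLE.cyclicRunsLE_dual {r : ℕ} {w : List Bool} (h : CyclicRunsLE r w) :
    CyclicRunsLE r (dual w) := by
  have := RunsLE.runsLE_dual h
  rwa [dual_append] at this

/-- `dual` reverses and negates, so the letter changes at the middle junction and also at the cyclic
one; no run gets longer. -/
theorem RunsLE.cyclicRunsLE_append_dual {r : ℕ} {x : List Bool} (h : RunsLE r x) :
    CyclicRunsLE r (x ++ dual x) := by
  rcases List.eq_nil_or_concat' x with rfl | ⟨x', a, hx⟩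
  · simpa [CyclicRunsLE, dual] using h
  obtain ⟨c, x'', hx'⟩ := List.exists_cons_of_ne_nil (l := x) (by simp [hx])
  have h1 : x.getLast? = some a := by simp [hx]
  have h2 : (dual x).head? = some !a := by simp [hx, dual]
  have h3 : x.head? = some c := by simp [hx']
  have h4 : (dual x).getLast? = some !c := by simp [hx', dual]
  have key : RunsLE r (x ++ dual x) := by
    refine h.append h.runsLE_dual ?_
    simp [h1, h2]
  refine key.append key ?_
  simp [List.getLast?_append, List.head?_append, h3, h4]

/-- The word `x` followed by two letters such that the cyclic runs stay bounded. -/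
def closeUp (x : List Bool) : List Bool := x ++ [!x.getLastD true, !x.headD true]

/-- The first new letter differs from the end of `x` and the second one from its start. The only
possible new run consists of the two new letters, hence `2 ≤ r`. -/
theorem RunsLE.cyclicRunsLE_closeUp {r : ℕ} (hr : 2 ≤ r) {x : List Bool} (hx : x ≠ [])
    (h : RunsLE r x) : CyclicRunsLE r (closeUp x) := by
  have h0 : RunsLE r [!x.getLastD true, !x.headD true] := by
    intro b hb
    have := hb.length_le
    simp at this
    omega
  have key : RunsLE r (closeUp x) := by
    refine h.append h0 ?_
    intro b hb
    simp [List.getLast?_eq_some_iff] at hb ⊢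
    obtain ⟨y, rfl⟩ := hb
    simp
  refine key.append key ?_
  obtain ⟨a, t, rfl⟩ := List.exists_cons_of_ne_nil hx
  have h1 : (closeUp (a :: t)).getLast? = some !a := by
    rw [closeUp, List.getLast?_append]
    simp
  have h2 : (closeUp (a :: t)).head? = some a := by simp [closeUp]
  simp [h1, h2]

theorem closeUp_injective : Function.Injective closeUp := by
  intro x y h
  have hl := congrArg List.length h
  simp [closeUp] at hl
  exact (List.append_inj h hl).1

@[simp] theorem length_closeUp (x : List Bool) : (closeUp x).length = x.length + 2 := by
  simp [closeUp]

/-! ### The free monoid of nonnegative matrices -/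

/-- The matrices of the two letters. -/
def letterMat : Bool → SL(2, ℤ)
  | true => ⟨!![1, 1; 0, 1], by simp⟩
  | false => ⟨!![1, 0; 1, 1], by simp⟩

/-- The matrix of a word. -/
def mat (w : List Bool) : SL(2, ℤ) := (w.map letterMat).prod

@[simp] theorem mat_nil : mat [] = 1 := rfl

theorem mat_cons (b : Bool) (w : List Bool) : mat (b :: w) = letterMat b * mat w := by
  simp [mat]

theorem mat_append (u v : List Bool) : mat (u ++ v) = mat u * mat v := by simp [mat]

theorem mat_wordPow (z : List Bool) (k : ℕ) : mat (wordPow z k) = mat z ^ k := by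
  induction k with
  | zero => simp
  | succ k ih => rw [wordPow_succ, mat_append, ih, pow_succ']

theorem det_entries (M : SL(2, ℤ)) : M.1 0 0 * M.1 1 1 - M.1 0 1 * M.1 1 0 = 1 := by
  rw [← Matrix.det_fin_two, M.2]

theorem mul_entry (M N : SL(2, ℤ)) (i j : Fin 2) :
    (M * N).1 i j = M.1 i 0 * N.1 0 j + M.1 i 1 * N.1 1 j := by
  rw [Matrix.SpecialLinearGroup.coe_mul, Matrix.mul_apply, Fin.sum_univ_two]

theorem coe_letterMat_true : (letterMat true).1 = !![1, 1; 0, 1] := rfl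

theorem coe_letterMat_false : (letterMat false).1 = !![1, 0; 1, 1] := rfl

theorem letterMat_true_mul (M : SL(2, ℤ)) (j : Fin 2) :
    (letterMat true * M).1 0 j = M.1 0 j + M.1 1 j ∧ (letterMat true * M).1 1 j = M.1 1 j := by
  simp [mul_entry, coe_letterMat_true]

theorem letterMat_false_mul (M : SL(2, ℤ)) (j : Fin 2) :
    (letterMat false * M).1 0 j = M.1 0 j ∧ (letterMat false * M).1 1 j = M.1 0 j + M.1 1 j := by
  simp [mul_entry, coe_letterMat_false]

/-- All entries are nonnegative. -/
def IsNonneg (M : SL(2, ℤ)) : Prop := ∀ i j, 0 ≤ M.1 i j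

theorem isNonneg_mat (w : List Bool) : IsNonneg (mat w) := by
  induction w with
  | nil => intro i j; fin_cases i <;> fin_cases j <;> simp
  | cons b w ih =>
    rw [mat_cons]
    intro i j
    have h0 := ih 0 j
    have h1 := ih 1 j
    cases b
    · fin_cases i
      · simpa [(letterMat_false_mul (mat w) j).1] using h0
      · simpa [(letterMat_false_mul (mat w) j).2] using add_nonneg h0 h1
    · fin_cases i
      · simpa [(letterMat_true_mul (mat w) j).1] using add_nonneg h0 h1
      · simpa [(letterMat_true_mul (mat w) j).2] using h1

theorem sl_ext {M N : SL(2, ℤ)} (h00 : M.1 0 0 = N.1 0 0) (h01 : M.1 0 1 = N.1 0 1)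
    (h10 : M.1 1 0 = N.1 1 0) (h11 : M.1 1 1 = N.1 1 1) : M = N := by
  apply Subtype.ext
  ext i j
  fin_cases i <;> fin_cases j <;> assumption

/-- A matrix whose first row dominates the second one is divisible by the first letter. -/
theorem exists_eq_letterMat_true_mul (M : SL(2, ℤ)) : ∃ N : SL(2, ℤ), M = letterMat true * N ∧
    N.1 0 0 = M.1 0 0 - M.1 1 0 ∧ N.1 0 1 = M.1 0 1 - M.1 1 1 ∧ N.1 1 0 = M.1 1 0 ∧
    N.1 1 1 = M.1 1 1 := by
  have h0 := letterMat_true_mul ((letterMat true)⁻¹ * M) 0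
  have h1 := letterMat_true_mul ((letterMat true)⁻¹ * M) 1
  rw [mul_inv_cancel_left] at h0 h1
  refine ⟨(letterMat true)⁻¹ * M, by simp, ?_, ?_, ?_, ?_⟩ <;> linarith [h0.1, h0.2, h1.1, h1.2]

theorem exists_eq_letterMat_false_mul (M : SL(2, ℤ)) : ∃ N : SL(2, ℤ), M = letterMat false * N ∧
    N.1 0 0 = M.1 0 0 ∧ N.1 0 1 = M.1 0 1 ∧ N.1 1 0 = M.1 1 0 - M.1 0 0 ∧
    N.1 1 1 = M.1 1 1 - M.1 0 1 := by
  have h0 := letterMat_false_mul ((letterMat false)⁻¹ * M) 0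
  have h1 := letterMat_false_mul ((letterMat false)⁻¹ * M) 1
  rw [mul_inv_cancel_left] at h0 h1
  refine ⟨(letterMat false)⁻¹ * M, by simp, ?_, ?_, ?_, ?_⟩ <;> linarith [h0.1, h0.2, h1.1, h1.2]

theorem isNonneg_of_entries {M : SL(2, ℤ)} (h00 : 0 ≤ M.1 0 0) (h01 : 0 ≤ M.1 0 1)
    (h10 : 0 ≤ M.1 1 0) (h11 : 0 ≤ M.1 1 1) : IsNonneg M := by
  intro i j
  fin_cases i <;> fin_cases j <;> assumption

/-- Every nonnegative matrix is the matrix of a word. -/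
theorem IsNonneg.exists_mat {M : SL(2, ℤ)} (hM : IsNonneg M) : ∃ w, mat w = M := by
  induction hn : (M.1 0 0 + M.1 0 1 + M.1 1 0 + M.1 1 1).toNat using Nat.strong_induction_on
    generalizing M with
  | _ n ih =>
    subst hn
    have h00 := hM 0 0
    have h01 := hM 0 1
    have h10 := hM 1 0
    have h11 := hM 1 1
    have hd := det_entries M
    -- Subtractive Euclid: if one row dominates the other, a letter splits off and the sum of the
    -- entries drops.
    by_cases c1 : M.1 1 0 ≤ M.1 0 0 ∧ M.1 1 1 ≤ M.1 0 1
    · obtain ⟨N, hN, e00, e01, e10, e11⟩ := exists_eq_letterMat_true_mul M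
      have hpos : 0 < M.1 1 0 + M.1 1 1 := by
        by_contra hcon
        have e1 : M.1 1 0 = 0 := by omega
        have e2 : M.1 1 1 = 0 := by omega
        simp [e1, e2] at hd
      obtain ⟨w, hw⟩ := ih _ (by rw [e00, e01, e10, e11]; omega)
        (isNonneg_of_entries (M := N) (by omega) (by omega) (by omega) (by omega)) rfl
      exact ⟨true :: w, by rw [mat_cons, hw, hN]⟩
    by_cases c2 : M.1 0 0 ≤ M.1 1 0 ∧ M.1 0 1 ≤ M.1 1 1
    · obtain ⟨N, hN, e00, e01, e10, e11⟩ := exists_eq_letterMat_false_mul M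
      have hpos : 0 < M.1 0 0 + M.1 0 1 := by
        by_contra hcon
        have e1 : M.1 0 0 = 0 := by omega
        have e2 : M.1 0 1 = 0 := by omega
        simp [e1, e2] at hd
      obtain ⟨w, hw⟩ := ih _ (by rw [e00, e01, e10, e11]; omega)
        (isNonneg_of_entries (M := N) (by omega) (by omega) (by omega) (by omega)) rfl
      exact ⟨false :: w, by rw [mat_cons, hw, hN]⟩
    -- Neither row dominates the other. If the diagonal is the smaller part, the determinant is
    -- negative; otherwise it is at least one plus the sum of the off-diagonal entries, so these
    -- vanish.
    refine ⟨[], ?_⟩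
    rcases lt_or_ge (M.1 0 0) (M.1 1 0) with c | c
    · have c' : M.1 1 1 < M.1 0 1 := by
        by_contra hcon
        exact c2 ⟨c.le, by omega⟩
      nlinarith
    · have c' : M.1 0 1 < M.1 1 1 := by
        by_contra hcon
        exact c1 ⟨c, by omega⟩
      have c'' : M.1 1 0 < M.1 0 0 := by
        by_contra hcon
        exact c2 ⟨by omega, c'.le⟩
      have e : M.1 0 1 + M.1 1 0 ≤ 0 := by nlinarith
      have e1 : M.1 0 1 = 0 := by omega
      have e2 : M.1 1 0 = 0 := by omega
      rw [e1, e2] at hd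
      have e3 : M.1 0 0 * M.1 1 1 = 1 := by linarith
      have e4 : M.1 0 0 = 1 := by nlinarith
      have e5 : M.1 1 1 = 1 := by rw [e4] at e3; linarith
      apply sl_ext <;> simp [e1, e2, e4, e5]

/-- The first letter can be read off from the row that dominates. If both rows dominated each other,
the first row of `M` would vanish. -/
theorem letterMat_true_mul_ne {M N : SL(2, ℤ)} (hM : IsNonneg M) (hN : IsNonneg N) :
    letterMat true * M ≠ letterMat false * N := by
  intro h
  have a0 := letterMat_true_mul M 0
  have a1 := letterMat_true_mul M 1
  have b0 := letterMat_false_mul N 0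
  have b1 := letterMat_false_mul N 1
  rw [h] at a0 a1
  have := hM 0 0
  have := hM 0 1
  have := hN 1 0
  have := hN 1 1
  have e1 : M.1 0 0 = 0 := by linarith [a0.1, a0.2, b0.1, b0.2]
  have e2 : M.1 0 1 = 0 := by linarith [a1.1, a1.2, b1.1, b1.2]
  have hd := det_entries M
  simp [e1, e2] at hd

theorem letterMat_mul_ne_one (b : Bool) {M : SL(2, ℤ)} (hM : IsNonneg M) : letterMat b * M ≠ 1 := by
  intro h
  have hd := det_entries M
  have h0 := hM 0 0
  have h1 := hM 1 1
  cases b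
  · have a0 := letterMat_false_mul M 0
    have a1 := letterMat_false_mul M 1
    rw [h] at a0 a1
    simp at a0 a1
    have := hM 1 0
    omega
  · have a0 := letterMat_true_mul M 0
    have a1 := letterMat_true_mul M 1
    rw [h] at a0 a1
    simp at a0 a1
    have := hM 0 1
    omega

theorem mat_injective : Function.Injective mat := by
  intro u v h
  induction u generalizing v with
  | nil =>
    cases v with
    | nil => rfl
    | cons b v => exact absurd h.symm (by rw [mat_cons]; exact letterMat_mul_ne_one b (isNonneg_mat v))
  | cons a u ih =>
    cases v with
    | nil => exact absurd h (by rw [mat_cons]; exact letterMat_mul_ne_one a (isNonneg_mat u))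
    | cons b v =>
      rw [mat_cons, mat_cons] at h
      cases a <;> cases b
      · rw [ih (mul_left_cancel h)]
      · exact absurd h.symm (letterMat_true_mul_ne (isNonneg_mat v) (isNonneg_mat u))
      · exact absurd h (letterMat_true_mul_ne (isNonneg_mat u) (isNonneg_mat v))
      · rw [ih (mul_left_cancel h)]

/-- Both letters occur in the word. -/
def Mixed (w : List Bool) : Prop := true ∈ w ∧ false ∈ w

theorem Mixed.of_isRotated {w w' : List Bool} (h : Mixed w) (hw : w ~r w') : Mixed w' :=
  ⟨hw.mem_iff.mp h.1, hw.mem_iff.mp h.2⟩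

theorem Mixed.mixed_dual {w : List Bool} (h : Mixed w) : Mixed (dual w) := by
  simpa [Mixed, dual, and_comm] using h

theorem one_le_diag_mat (w : List Bool) : 1 ≤ (mat w).1 0 0 ∧ 1 ≤ (mat w).1 1 1 ∧
    (true ∈ w → 1 ≤ (mat w).1 0 1) ∧ (false ∈ w → 1 ≤ (mat w).1 1 0) := by
  induction w with
  | nil => simp
  | cons b w ih =>
    rw [mat_cons]
    obtain ⟨h1, h2, h3, h4⟩ := ih
    have n01 := isNonneg_mat w 0 1
    have n10 := isNonneg_mat w 1 0
    cases b
    · rw [(letterMat_false_mul (mat w) 0).1, (letterMat_false_mul (mat w) 0).2,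
        (letterMat_false_mul (mat w) 1).1, (letterMat_false_mul (mat w) 1).2]
      refine ⟨h1, by omega, by simpa using h3, fun _ => by omega⟩
    · rw [(letterMat_true_mul (mat w) 0).1, (letterMat_true_mul (mat w) 0).2,
        (letterMat_true_mul (mat w) 1).1, (letterMat_true_mul (mat w) 1).2]
      refine ⟨by omega, h2, fun _ => by omega, by simpa using h4⟩

theorem Mixed.one_le_mat {w : List Bool} (h : Mixed w) (i j : Fin 2) : 1 ≤ (mat w).1 i j := by
  obtain ⟨h1, h2, h3, h4⟩ := one_le_diag_mat w
  fin_cases i <;> fin_cases j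
  exacts [h1, h3 h.1, h4 h.2, h2]

/-- The product of the diagonal entries is one plus a positive integer, so they are not both equal
to one. -/
theorem Mixed.three_le_trace {w : List Bool} (h : Mixed w) : 3 ≤ (mat w).1 0 0 + (mat w).1 1 1 := by
  have := det_entries (mat w)
  have h00 := h.one_le_mat 0 0
  have h01 := h.one_le_mat 0 1
  have h10 := h.one_le_mat 1 0
  have h11 := h.one_le_mat 1 1
  nlinarith

/-- The matrix of a word in one letter only has trace two. -/
theorem trace_mat_of_not_mixed {w : List Bool} (h : ¬ Mixed w) :
    (mat w).1 0 0 = 1 ∧ (mat w).1 1 1 = 1 := by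
  have key : (true ∉ w → (mat w).1 0 0 = 1 ∧ (mat w).1 1 1 = 1 ∧ (mat w).1 0 1 = 0) ∧
      (false ∉ w → (mat w).1 0 0 = 1 ∧ (mat w).1 1 1 = 1 ∧ (mat w).1 1 0 = 0) := by
    clear h
    induction w with
    | nil => simp
    | cons b w ih =>
      rw [mat_cons]
      cases b
      · rw [(letterMat_false_mul (mat w) 0).1, (letterMat_false_mul (mat w) 0).2,
          (letterMat_false_mul (mat w) 1).1, (letterMat_false_mul (mat w) 1).2]
        refine ⟨fun h => ?_, fun h => by simp at h⟩
        obtain ⟨h1, h2, h3⟩ := ih.1 (by simpa using h)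
        omega
      · rw [(letterMat_true_mul (mat w) 0).1, (letterMat_true_mul (mat w) 0).2,
          (letterMat_true_mul (mat w) 1).1, (letterMat_true_mul (mat w) 1).2]
        refine ⟨fun h => by simp at h, fun h => ?_⟩
        obtain ⟨h1, h2, h3⟩ := ih.2 (by simpa using h)
        omega
  by_cases ht : true ∈ w
  · obtain ⟨h1, h2, -⟩ := key.2 fun hf => h ⟨ht, hf⟩
    exact ⟨h1, h2⟩
  · obtain ⟨h1, h2, -⟩ := key.1 ht
    exact ⟨h1, h2⟩

/-- The matrix of `dual w` is the transpose of the matrix of `w`. -/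
theorem mat_dual (w : List Bool) (i j : Fin 2) : (mat (dual w)).1 i j = (mat w).1 j i := by
  have h : (mat (dual w)).1 = (mat w).1.transpose := by
    induction w with
    | nil => simp [dual]
    | cons b w ih =>
      rw [show dual (b :: w) = dual w ++ [!b] by simp [dual], mat_append, mat_cons b w]
      simp only [Matrix.SpecialLinearGroup.coe_mul, Matrix.transpose_mul, ← ih]
      congr 1
      ext i j
      cases b <;> fin_cases i <;> fin_cases j <;>
        simp [mat, coe_letterMat_true, coe_letterMat_false]
  rw [h, Matrix.transpose_apply]

/-! ### Conjugate positive matrices -/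

/-- The orbit of a nonzero vector under the powers of a positive matrix ends up in the open first
or third quadrant. -/
theorem exists_mul_pos_of_pow (Q : SL(2, ℤ)) (hQ : ∀ i j, 1 ≤ Q.1 i j) (v : Fin 2 → ℤ)
    (hv : v ≠ 0) : ∃ k, ∀ l, k ≤ l → 0 < ((Q ^ l).1.mulVec v) 0 * ((Q ^ l).1.mulVec v) 1 := by
  have hd := det_entries Q
  have h00 := hQ 0 0
  have h01 := hQ 0 1
  have h10 := hQ 1 0
  have h11 := hQ 1 1
  have hm : ∀ v : Fin 2 → ℤ, Q.1.mulVec v 0 = Q.1 0 0 * v 0 + Q.1 0 1 * v 1 ∧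
      Q.1.mulVec v 1 = Q.1 1 0 * v 0 + Q.1 1 1 * v 1 := by
    intro v
    simp [Matrix.mulVec, dotProduct, Fin.sum_univ_two]
  have hstay : ∀ v : Fin 2 → ℤ, 0 < v 0 * v 1 → 0 < Q.1.mulVec v 0 * Q.1.mulVec v 1 := by
    intro v hv
    rw [(hm v).1, (hm v).2]
    rcases mul_pos_iff.mp hv with ⟨h1, h2⟩ | ⟨h1, h2⟩
    · positivity
    · refine mul_pos_of_neg_of_neg ?_ ?_ <;> nlinarith
  have hstep : ∀ l (v : Fin 2 → ℤ), (Q ^ (l + 1)).1.mulVec v = (Q ^ l).1.mulVec (Q.1.mulVec v) := by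
    intro l v
    rw [pow_succ, Matrix.SpecialLinearGroup.coe_mul, Matrix.mulVec_mulVec]
  have hall : ∀ l (v : Fin 2 → ℤ), 0 < v 0 * v 1 →
      0 < (Q ^ l).1.mulVec v 0 * (Q ^ l).1.mulVec v 1 := by
    intro l
    induction l with
    | zero => intro v hv; simpa using hv
    | succ l ih => intro v hv; rw [hstep]; exact ih _ (hstay v hv)
  induction hn : (|v 0| + |v 1|).toNat using Nat.strong_induction_on generalizing v with
  | _ n ih =>
    subst hn
    by_cases hp : 0 < v 0 * v 1
    · exact ⟨0, fun l _ => hall l v hp⟩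
    have e0 : v 0 = Q.1 1 1 * Q.1.mulVec v 0 - Q.1 0 1 * Q.1.mulVec v 1 := by
      rw [(hm v).1, (hm v).2]; linear_combination (-v 0) * hd
    have e1 : v 1 = Q.1 0 0 * Q.1.mulVec v 1 - Q.1 1 0 * Q.1.mulVec v 0 := by
      rw [(hm v).1, (hm v).2]; linear_combination (-v 1) * hd
    set u := Q.1.mulVec v with hu
    have hu0 : u ≠ 0 := by
      intro h0
      apply hv
      ext i
      fin_cases i
      · simpa [h0] using e0
      · simpa [h0] using e1
    have hlt : ∀ k, (∀ l, k ≤ l → 0 < (Q ^ l).1.mulVec u 0 * (Q ^ l).1.mulVec u 1) →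
        ∀ l, k + 1 ≤ l → 0 < (Q ^ l).1.mulVec v 0 * (Q ^ l).1.mulVec v 1 := by
      intro k hk l hl
      obtain ⟨l, rfl⟩ := Nat.exists_eq_add_of_le' (by omega : 1 ≤ l)
      rw [hstep]
      exact hk l (by omega)
    by_cases hp' : 0 < u 0 * u 1
    · exact ⟨1, hlt 0 fun l _ => hall l u hp'⟩
    have hpos : 0 < |u 0| + |u 1| := by
      by_contra hcon
      apply hu0
      have := abs_nonneg (u 0)
      have := abs_nonneg (u 1)
      ext i
      fin_cases i
      · exact abs_eq_zero.mp (show |u 0| = 0 by omega)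
      · exact abs_eq_zero.mp (show |u 1| = 0 by omega)
    -- The coordinates of `u` do not have the same strict sign and `Q` has positive entries, so
    -- nothing cancels in `v = Q⁻¹ u`. Each step outside the two quadrants thus lowers the norm, and
    -- the descent ends.
    have hlt' : |u 0| + |u 1| < |v 0| + |v 1| := by
      have hle : u 0 * u 1 ≤ 0 := not_lt.mp hp'
      rw [e0, e1]
      rcases mul_nonpos_iff.mp hle with ⟨h1, h2⟩ | ⟨h1, h2⟩
      · rw [abs_of_nonneg h1, abs_of_nonpos h2] at *
        have t1 := le_abs_self (Q.1 1 1 * u 0 - Q.1 0 1 * u 1)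
        have t2 := neg_abs_le (Q.1 0 0 * u 1 - Q.1 1 0 * u 0)
        nlinarith
      · rw [abs_of_nonpos h1, abs_of_nonneg h2] at *
        have t1 := neg_abs_le (Q.1 1 1 * u 0 - Q.1 0 1 * u 1)
        have t2 := le_abs_self (Q.1 0 0 * u 1 - Q.1 1 0 * u 0)
        nlinarith
    obtain ⟨k, hk⟩ := ih (|u 0| + |u 1|).toNat (by omega) u hu0 rfl
    exact ⟨k + 1, hlt k hk⟩

/-- An element that conjugates one positive matrix to another becomes, up to sign, the matrix of a
word after multiplication by a power. -/
theorem exists_mat_eq_mul_pow {P Q g : SL(2, ℤ)} (hP : ∀ i j, 1 ≤ P.1 i j)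
    (hQ : ∀ i j, 1 ≤ Q.1 i j) (h : g * P = Q * g) :
    ∃ l n, mat n = g * P ^ l ∨ mat n = -(g * P ^ l) := by
  have hpow : ∀ l, g * P ^ l = Q ^ l * g := by
    intro l
    exact (SemiconjBy.pow_right (show SemiconjBy g P Q from h) l)
  have hcol : ∀ j, (fun i => g.1 i j) ≠ 0 := by
    intro j h0
    have hd := det_entries g
    have a0 := congrFun h0 0
    have a1 := congrFun h0 1
    fin_cases j <;> simp_all
  have hrow : ∀ i, (fun j => g.1 i j) ≠ 0 := by
    intro i h0
    have hd := det_entries g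
    have a0 := congrFun h0 0
    have a1 := congrFun h0 1
    fin_cases i <;> simp_all
  -- The columns of `g P^l = Q^l g` move under `Q`, its rows under the transpose of `P`. For large
  -- `l` each row and each column has entries of one strict sign, so all four entries agree in sign.
  choose k hk using fun j => exists_mul_pos_of_pow Q hQ _ (hcol j)
  choose k' hk' using fun i => exists_mul_pos_of_pow P.transpose
    (fun i j => hP j i) _ (hrow i)
  set l := k 0 + k 1 + k' 0 + k' 1 with hl
  have hN1 : ∀ i j, ((Q ^ l).1.mulVec fun i => g.1 i j) i = (g * P ^ l).1 i j := by
    intro i j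
    rw [hpow l]
    rfl
  have hN2 : ∀ i j, ((P.transpose ^ l).1.mulVec fun j => g.1 i j) j = (g * P ^ l).1 i j := by
    intro i j
    rw [Matrix.SpecialLinearGroup.coe_pow, Matrix.SpecialLinearGroup.coe_transpose,
      ← Matrix.transpose_pow, Matrix.mulVec_transpose]
    rfl
  have c0 := hk 0 l (by omega)
  have c1 := hk 1 l (by omega)
  have r0 := hk' 0 l (by omega)
  have r1 := hk' 1 l (by omega)
  rw [hN1, hN1] at c0 c1
  rw [hN2, hN2] at r0 r1
  set N := g * P ^ l with hN
  refine ⟨l, ?_⟩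
  rcases lt_trichotomy 0 (N.1 0 0) with hs | hs | hs
  · have h10 := pos_of_mul_pos_right c0 hs.le
    have h01 := pos_of_mul_pos_right r0 hs.le
    have h11 := pos_of_mul_pos_right r1 h10.le
    obtain ⟨n, hn⟩ := (isNonneg_of_entries hs.le h01.le h10.le h11.le).exists_mat
    exact ⟨n, Or.inl hn⟩
  · rw [← hs] at c0; simp at c0
  · have h10 := neg_of_mul_pos_right c0 hs.le
    have h01 := neg_of_mul_pos_right r0 hs.le
    have h11 := neg_of_mul_pos_right r1 h10.le
    obtain ⟨n, hn⟩ := (isNonneg_of_entries (M := -N) (by simpa using hs.le) (by simpa using h01.le)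
      (by simpa using h10.le) (by simpa using h11.le)).exists_mat
    exact ⟨n, Or.inr hn⟩

/-! ### The modular group -/

/-- The quotient map `SL(2, ℤ) → PSL(2, ℤ)`. -/
def toGam : SL(2, ℤ) →* Gam := QuotientGroup.mk' _

theorem mk_eq_toGam (M : SL(2, ℤ)) : (QuotientGroup.mk M : Gam) = toGam M := rfl

theorem toGam_surjective : Function.Surjective toGam := QuotientGroup.mk'_surjective _

theorem toGam_neg (M : SL(2, ℤ)) : toGam (-M) = toGam M := by
  have h : toGam (-1) = 1 := by
    refine (QuotientGroup.eq_one_iff _).mpr ?_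
    rw [Matrix.SpecialLinearGroup.mem_center_iff]
    exact ⟨-1, by simp, by ext i j; fin_cases i <;> fin_cases j <;> simp⟩
  rw [← neg_one_mul, map_mul, h, one_mul]

theorem toGam_eq_iff {M N : SL(2, ℤ)} : toGam M = toGam N ↔ M = N ∨ M = -N := by
  constructor
  · intro h
    have h' := QuotientGroup.eq.mp h
    rw [Matrix.SpecialLinearGroup.mem_center_iff] at h'
    obtain ⟨r, hr, he⟩ := h'
    have hN : N.1 = M.1 * Matrix.scalar (Fin 2) r := by
      rw [he, ← Matrix.SpecialLinearGroup.coe_mul, mul_inv_cancel_left]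
    have hr' : r = 1 ∨ r = -1 := by simpa using hr
    rcases hr' with rfl | rfl
    · left
      apply Subtype.ext
      rw [hN]
      simp
    · right
      apply Subtype.ext
      rw [Matrix.SpecialLinearGroup.coe_neg, hN]
      ext i j
      simp [Matrix.scalar]
  · rintro (rfl | rfl)
    · rfl
    · exact toGam_neg N

/-- The trace of a matrix in `SL(2, ℤ)`. -/
def tr (M : SL(2, ℤ)) : ℤ := M.1 0 0 + M.1 1 1

theorem trace_eq_tr (M : SL(2, ℤ)) : M.1.trace = tr M := Matrix.trace_fin_two _

@[simp] theorem tr_neg (M : SL(2, ℤ)) : tr (-M) = -tr M := by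
  simp [tr]; ring

theorem tr_mul_comm (M N : SL(2, ℤ)) : tr (M * N) = tr (N * M) := by
  simp only [tr, mul_entry]; ring

theorem tr_conj {C M N : SL(2, ℤ)} (h : C * M = N * C) : tr M = tr N := by
  have : N = C * M * C⁻¹ := by rw [h, mul_inv_cancel_right]
  rw [this, tr_mul_comm, inv_mul_cancel_left]

theorem isConj_toGam_iff {M N : SL(2, ℤ)} :
    IsConj (toGam M) (toGam N) ↔ ∃ C : SL(2, ℤ), C * M = N * C ∨ C * M = -(N * C) := by
  rw [isConj_iff]
  constructor
  · rintro ⟨c, hc⟩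
    obtain ⟨C, rfl⟩ := toGam_surjective c
    refine ⟨C, ?_⟩
    rw [← toGam_eq_iff, map_mul, map_mul, ← hc, inv_mul_cancel_right]
  · rintro ⟨C, hC⟩
    refine ⟨toGam C, ?_⟩
    rw [← toGam_eq_iff, map_mul, map_mul] at hC
    rw [hC, mul_inv_cancel_right]

theorem abs_tr_of_isConj {M N : SL(2, ℤ)} (h : IsConj (toGam M) (toGam N)) : |tr M| = |tr N| := by
  obtain ⟨C, hC | hC⟩ := isConj_toGam_iff.mp h
  · rw [tr_conj hC]
  · rw [← neg_mul] at hC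
    rw [tr_conj hC, tr_neg, abs_neg]

theorem isConj_of_eq {G : Type*} [Group G] {u v : G} (h : u = v) : IsConj u v := h ▸ IsConj.refl u

theorem isConj_mul_comm {G : Type*} [Group G] (u v : G) : IsConj (u * v) (v * u) :=
  isConj_iff.mpr ⟨u⁻¹, by group⟩

theorem isHyperbolic_toGam {M : SL(2, ℤ)} : IsHyperbolic (toGam M) ↔ 2 < |tr M| := by
  constructor
  · rintro ⟨N, hN, h⟩
    rw [trace_eq_tr] at h
    rw [mk_eq_toGam] at hN
    rwa [← abs_tr_of_isConj (hN ▸ IsConj.refl _ : IsConj (toGam N) (toGam M))]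
  · exact fun h => ⟨M, rfl, by rwa [trace_eq_tr]⟩

/-- The conjugacy class of a word. -/
def cls (w : List Bool) : ConjClasses Gam := ConjClasses.mk (toGam (mat w))

theorem Mixed.three_le_tr {w : List Bool} (h : Mixed w) : 3 ≤ tr (mat w) := h.three_le_trace

/-- A conjugator multiplied by a power of `mat u` is still one, and for a high power it is the
matrix of a word `n` up to sign. Freeness turns this into `n ++ u = v ++ n`. Lifts that are
conjugate only up to sign are excluded because both traces are positive. -/
theorem Mixed.isRotated_of_isConj {u v : List Bool} (hu : Mixed u) (hv : Mixed v)
    (h : IsConj (toGam (mat u)) (toGam (mat v))) : u ~r v := by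
  obtain ⟨C, hC | hC⟩ := isConj_toGam_iff.mp h
  · obtain ⟨l, n, hn⟩ := exists_mat_eq_mul_pow hu.one_le_mat hv.one_le_mat hC
    apply isRotated_of_conj n
    apply mat_injective
    rw [mat_append, mat_append]
    have key : C * mat u ^ l * mat u = mat v * (C * mat u ^ l) := by
      rw [mul_assoc, ← pow_succ, pow_succ', ← mul_assoc, hC, mul_assoc]
    rcases hn with hn | hn
    · rw [hn, key]
    · rw [hn, neg_mul, key, mul_neg]
  · rw [← neg_mul] at hC
    have := tr_conj hC
    rw [tr_neg] at this
    have := hu.three_le_tr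
    have := hv.three_le_tr
    omega

theorem cls_eq_of_isRotated {u v : List Bool} (h : u ~r v) : cls u = cls v := by
  obtain ⟨j, hj, rfl⟩ := List.isRotated_iff_mod.mp h
  rw [List.rotate_eq_drop_append_take hj, cls, cls, ConjClasses.mk_eq_mk_iff_isConj]
  conv_lhs => rw [← List.take_append_drop j u]
  rw [mat_append, mat_append, map_mul, map_mul]
  exact isConj_mul_comm _ _

/-- Two words give the same closed geodesic exactly if they are rotations of each other. -/
theorem Mixed.cls_eq_iff {u v : List Bool} (hu : Mixed u) (hv : Mixed v) :
    cls u = cls v ↔ u ~r v :=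
  ⟨fun h => hu.isRotated_of_isConj hv (ConjClasses.mk_eq_mk_iff_isConj.mp h), cls_eq_of_isRotated⟩

/-! ### Words in the generators -/

/-- The generator of order three and its inverse. -/
def genPow (b : Bool) : Gam := if b then genB else genB⁻¹

/-- The letters of words in the generators. -/
def IsLetter (x : Gam) : Prop := x = genA ∨ x = genB ∨ x = genB⁻¹

theorem isLetter_iff {x : Gam} : IsLetter x ↔ x = genA ∨ ∃ b, x = genPow b := by
  simp [IsLetter, genPow, or_comm]

theorem genA_eq : genA = toGam matA := rfl

theorem genB_eq : genB = toGam matB := rfl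

theorem coe_matA : matA.1 = !![0, -1; 1, 0] := rfl

theorem coe_matB : matB.1 = !![1, -1; 1, 0] := rfl

theorem genA_mul_genA : genA * genA = 1 := by
  rw [genA_eq, ← map_mul, ← map_one toGam, toGam_eq_iff]
  right
  apply sl_ext <;> simp [mul_entry, coe_matA]

theorem genB_pow : genB * genB * genB = 1 := by
  rw [genB_eq, ← map_mul, ← map_mul, ← map_one toGam, toGam_eq_iff]
  right
  apply sl_ext <;> simp [mul_entry, coe_matB]

theorem genPow_mul_self (b : Bool) : genPow b * genPow b = genPow !b := by
  have h : genB * genB = genB⁻¹ := eq_inv_of_mul_eq_one_left genB_pow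
  cases b
  · simp only [genPow, Bool.false_eq_true, if_false, Bool.not_false, if_true]
    rw [← mul_inv_rev, h, inv_inv]
  · simpa [genPow] using h

theorem genPow_mul_not (b : Bool) : genPow b * genPow (!b) = 1 := by
  cases b <;> simp [genPow]

theorem toGam_letterMat (b : Bool) : toGam (letterMat b) = genPow b * genA := by
  cases b
  · rw [genPow, if_neg (by simp), eq_inv_mul_iff_mul_eq, genA_eq, genB_eq, ← map_mul, toGam_eq_iff]
    left
    apply sl_ext <;> simp [mul_entry, coe_matB, coe_matA, coe_letterMat_false]
  · rw [genPow, if_pos rfl, genA_eq, genB_eq, ← map_mul, toGam_eq_iff]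
    right
    apply sl_ext <;> simp [coe_matB, coe_matA, coe_letterMat_true]

theorem toGam_mat_cons (b : Bool) (w : List Bool) :
    toGam (mat (b :: w)) = genPow b * (genA * toGam (mat w)) := by
  rw [mat_cons, map_mul, toGam_letterMat, mul_assoc]

theorem toGam_mat_concat (b : Bool) (w : List Bool) :
    toGam (mat (w ++ [b])) = toGam (mat w) * genPow b * genA := by
  rw [mat_append, map_mul, mat_cons, mat_nil, mul_one, toGam_letterMat, mul_assoc]

/-- The initial part of a reduced word. -/
def optA (x : Bool) : Gam := if x then genA else 1

/-- The final part of a reduced word. -/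
def optB : Option Bool → Gam
  | none => 1
  | some b => genPow b

/-- Reduction of words in the generators. -/
theorem exists_reduced (l : List Gam) (hl : ∀ x ∈ l, IsLetter x) :
    ∃ (x : Bool) (w : List Bool) (y : Option Bool),
      l.prod = optA x * (toGam (mat w) * optB y) ∧
      x.toNat + 2 * w.length + y.isSome.toNat ≤ l.length := by
  induction l with
  | nil => exact ⟨false, [], none, by simp [optA, optB], by simp⟩
  | cons s l ih =>
    obtain ⟨x, w, y, he, hlen⟩ := ih fun z hz => hl z (List.mem_cons_of_mem _ hz)
    rw [List.prod_cons, he, List.length_cons]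
    -- A letter put in front interacts only with the first syllable: `a` cancels `a`, equal powers
    -- of `b` merge to the inverse power, opposite ones cancel.
    rcases isLetter_iff.mp (hl s List.mem_cons_self) with rfl | ⟨b, rfl⟩
    · cases x
      · exact ⟨true, w, y, by simp [optA], by simp at hlen ⊢; omega⟩
      · refine ⟨false, w, y, ?_, by simp at hlen ⊢; omega⟩
        simp only [optA, if_true, Bool.false_eq_true, if_false, one_mul]
        rw [← mul_assoc, genA_mul_genA, one_mul]
    · cases x
      · cases w with
        | nil =>
          cases y with
          | none => exact ⟨false, [], some b, by simp [optA, optB], by simp⟩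
          | some c =>
            rcases Bool.eq_or_eq_not c b with rfl | rfl
            · exact ⟨false, [], some !c, by simp [optA, optB, genPow_mul_self], by simp⟩
            · exact ⟨false, [], none, by simp [optA, optB, genPow_mul_not], by simp⟩
        | cons c w =>
          rw [toGam_mat_cons]
          rcases Bool.eq_or_eq_not c b with rfl | rfl
          · refine ⟨false, (!c) :: w, y, ?_, by simp at hlen ⊢; omega⟩
            rw [toGam_mat_cons, ← genPow_mul_self]
            simp [optA, mul_assoc]
          · refine ⟨true, w, y, ?_, by simp at hlen ⊢; omega⟩
            simp only [optA, Bool.false_eq_true, if_false, if_true, one_mul]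
            rw [mul_assoc, ← mul_assoc, genPow_mul_not, one_mul, mul_assoc]
      · refine ⟨false, b :: w, y, ?_, by simp at hlen ⊢; omega⟩
        rw [toGam_mat_cons]
        simp [optA, mul_assoc]

/-- The element is conjugate to a letter or to the matrix of a word of bounded length. -/
def IsCyclicallyReducible (g : Gam) (n : ℕ) : Prop :=
  (∃ x, IsLetter x ∧ IsConj g x) ∨ ∃ w, IsConj g (toGam (mat w)) ∧ 2 * w.length ≤ n

theorem IsCyclicallyReducible.of_isConj {g h : Gam} {n k : ℕ} (hg : IsCyclicallyReducible h k)
    (hc : IsConj g h) (hk : k ≤ n) : IsCyclicallyReducible g n := by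
  rcases hg with ⟨x, hx, hc'⟩ | ⟨w, hw, hc'⟩
  · exact Or.inl ⟨x, hx, hc.trans hc'⟩
  · exact Or.inr ⟨w, hc.trans hw, hc'.trans hk⟩

/-- Normal forms of odd length are not cyclically reduced. In `a w` the final `a` of `w` cancels,
which leaves a form `w' b^±1`. In `w b^±1` the two powers of `b` meet cyclically: they merge and
give a word, or cancel and leave a shorter form `a w'`. Hence a joint induction. -/
theorem isCyclicallyReducible_aux (n : ℕ) (w : List Bool) (hw : w.length = n) :
    IsCyclicallyReducible (genA * toGam (mat w)) (2 * n + 1) ∧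
    ∀ b, IsCyclicallyReducible (toGam (mat w) * genPow b) (2 * n + 1) := by
  induction n using Nat.strong_induction_on generalizing w with
  | _ n ih =>
    constructor
    · rcases List.eq_nil_or_concat' w with rfl | ⟨w', b, rfl⟩
      · exact Or.inl ⟨genA, Or.inl rfl, isConj_of_eq (by simp)⟩
      · have hlt : w'.length < n := by simp at hw; omega
        refine ((ih _ hlt w' rfl).2 b).of_isConj ?_ (by omega)
        rw [toGam_mat_concat]
        have := isConj_mul_comm genA (toGam (mat w') * genPow b * genA)
        rwa [mul_assoc _ genA genA, genA_mul_genA, mul_one] at this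
    · intro b
      cases w with
      | nil => exact Or.inl ⟨genPow b, isLetter_iff.mpr (Or.inr ⟨b, rfl⟩), isConj_of_eq (by simp)⟩
      | cons c w' =>
        have hlt : w'.length < n := by simp at hw; omega
        have hc := isConj_mul_comm (toGam (mat (c :: w'))) (genPow b)
        rw [toGam_mat_cons] at hc ⊢
        rcases Bool.eq_or_eq_not c b with rfl | rfl
        · rw [← mul_assoc (genPow c) (genPow c), genPow_mul_self, ← toGam_mat_cons (!c)] at hc
          exact Or.inr ⟨_, hc, by simp at hw ⊢; omega⟩
        · rw [← mul_assoc (genPow b) (genPow _), genPow_mul_not, one_mul] at hc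
          exact (ih _ hlt w' rfl).1.of_isConj hc (by omega)

theorem isCyclicallyReducible_prod (l : List Gam) (hl : ∀ x ∈ l, IsLetter x) :
    IsCyclicallyReducible l.prod l.length := by
  obtain ⟨x, w, y, he, hlen⟩ := exists_reduced l hl
  rw [he]
  cases x
  · cases y with
    | none => exact Or.inr ⟨w, isConj_of_eq (by simp [optA, optB]), by simp at hlen; omega⟩
    | some b =>
      refine ((isCyclicallyReducible_aux _ w rfl).2 b).of_isConj (isConj_of_eq (by simp [optA, optB])) ?_
      simpa using hlen
  · cases y with
    | none =>
      refine (isCyclicallyReducible_aux _ w rfl).1.of_isConj (isConj_of_eq (by simp [optA, optB])) ?_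
      simpa [add_comm] using hlen
    | some b =>
      refine Or.inr ⟨w ++ [b], ?_, by simp at hlen ⊢; omega⟩
      rw [toGam_mat_concat]
      exact isConj_mul_comm _ _

/-- Makes the sets in `wordLength` and `classLength` nonempty, so that the infima are attained and
are not the default value of `sInf ∅`. -/
theorem exists_letters (g : Gam) : ∃ l : List Gam, (∀ x ∈ l, IsLetter x) ∧ l.prod = g := by
  obtain ⟨M, rfl⟩ := toGam_surjective g
  have hA : IsLetter genA := Or.inl rfl
  have hB : IsLetter genB := Or.inr (Or.inl rfl)
  have hB' : IsLetter genB⁻¹ := Or.inr (Or.inr rfl)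
  have hS : toGam ModularGroup.S = genA := rfl
  have hT : toGam ModularGroup.T = genB * genA := by
    have := toGam_letterMat true
    exact this
  have hAinv : genA⁻¹ = genA := inv_eq_of_mul_eq_one_left genA_mul_genA
  have hM : M ∈ Subgroup.closure {ModularGroup.S, ModularGroup.T} := by
    rw [SpecialLinearGroup.SL2Z_generators]; trivial
  induction hM using Subgroup.closure_induction'' with
  | mem x hx =>
    rcases hx with rfl | rfl
    · exact ⟨[genA], by simpa using hA, by simp [hS]⟩
    · exact ⟨[genB, genA], by simp [hA, hB], by simp [hT]⟩
  | inv_mem x hx =>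
    rcases hx with rfl | rfl
    · exact ⟨[genA], by simpa using hA, by simp [hS, hAinv]⟩
    · exact ⟨[genA, genB⁻¹], by simp [hA, hB'], by simp [hT, hAinv]⟩
  | one => exact ⟨[], by simp, by simp⟩
  | mul x y _ _ hx hy =>
    obtain ⟨l, hl, hlx⟩ := hx
    obtain ⟨l', hl', hly⟩ := hy
    refine ⟨l ++ l', ?_, by simp [hlx, hly]⟩
    intro z hz
    rcases List.mem_append.mp hz with hz | hz
    exacts [hl z hz, hl' z hz]

theorem wordLength_spec (g : Gam) :
    ∃ l : List Gam, (∀ x ∈ l, IsLetter x) ∧ l.prod = g ∧ l.length = wordLength g := by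
  have := Nat.sInf_mem (s := {n | ∃ l : List Gam, (∀ x ∈ l, x = genA ∨ x = genB ∨ x = genB⁻¹) ∧
    l.prod = g ∧ l.length = n})
  obtain ⟨l, hl, he⟩ := exists_letters g
  exact this ⟨_, l, hl, he, rfl⟩

theorem classLength_spec (c : ConjClasses Gam) :
    ∃ l : List Gam, (∀ x ∈ l, IsLetter x) ∧ ConjClasses.mk l.prod = c ∧
      l.length = classLength c := by
  obtain ⟨g, rfl⟩ := ConjClasses.exists_rep c
  have := Nat.sInf_mem (s := {n | ∃ h : Gam, ConjClasses.mk h = ConjClasses.mk g ∧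
    wordLength h = n}) ⟨_, g, rfl, rfl⟩
  obtain ⟨h, hh, hl⟩ := this
  obtain ⟨l, hl', hp, hlen⟩ := wordLength_spec h
  exact ⟨l, hl', by rw [hp, hh], hlen.trans hl⟩

theorem classLength_cls_le (w : List Bool) : classLength (cls w) ≤ 2 * w.length := by
  have h : ∃ l : List Gam, (∀ x ∈ l, IsLetter x) ∧ l.prod = toGam (mat w) ∧
      l.length = 2 * w.length := by
    induction w with
    | nil => exact ⟨[], by simp, by simp, rfl⟩
    | cons b w ih =>
      obtain ⟨l, hl, hp, hlen⟩ := ih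
      refine ⟨genPow b :: genA :: l, ?_, ?_, ?_⟩
      · intro x hx
        simp only [List.mem_cons] at hx
        rcases hx with rfl | rfl | hx
        exacts [isLetter_iff.mpr (Or.inr ⟨b, rfl⟩), Or.inl rfl, hl x hx]
      · rw [List.prod_cons, List.prod_cons, hp, toGam_mat_cons]
      · simp only [List.length_cons]; omega
  obtain ⟨l, hl, hp, hlen⟩ := h
  rw [← hlen]
  calc classLength (cls w) ≤ wordLength (toGam (mat w)) := Nat.sInf_le ⟨_, rfl, rfl⟩
    _ ≤ l.length := Nat.sInf_le ⟨l, hl, hp, rfl⟩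

theorem not_isHyperbolic_of_isLetter {x : Gam} (hx : IsLetter x) : ¬ IsHyperbolic x := by
  rcases isLetter_iff.mp hx with rfl | ⟨b, rfl⟩
  · rw [genA_eq, isHyperbolic_toGam]
    simp [tr, coe_matA]
  · cases b
    · rw [genPow, if_neg (by simp), genB_eq, ← map_inv, isHyperbolic_toGam]
      simp [tr, coe_matB, Matrix.adjugate_fin_two]
    · rw [genPow, if_pos rfl, genB_eq, isHyperbolic_toGam]
      simp [tr, coe_matB]

theorem IsHyperbolic.of_isConj {g h : Gam} (hg : IsHyperbolic g) (hc : IsConj g h) :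
    IsHyperbolic h := by
  obtain ⟨M, rfl⟩ := toGam_surjective g
  obtain ⟨N, rfl⟩ := toGam_surjective h
  rw [isHyperbolic_toGam] at *
  rwa [← abs_tr_of_isConj hc]

theorem isHyperbolic_toGam_mat {w : List Bool} : IsHyperbolic (toGam (mat w)) ↔ Mixed w := by
  rw [isHyperbolic_toGam]
  constructor
  · intro h
    by_contra hm
    obtain ⟨h1, h2⟩ := trace_mat_of_not_mixed hm
    simp [tr, h1, h2] at h
  · intro h
    have := h.three_le_tr
    rw [abs_of_nonneg (by omega)]
    omega

/-- A shortest representative of the class is cyclically reduced without gain of length; it cannot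
end in a single letter, since `a` and `b^±1` are elliptic. -/
theorem IsClosedGeodesic.exists_word {c : ConjClasses Gam} (h : IsClosedGeodesic c) :
    ∃ w, Mixed w ∧ cls w = c ∧ 2 * w.length ≤ classLength c := by
  obtain ⟨g, hg, hh⟩ := h
  obtain ⟨l, hl, hp, hlen⟩ := classLength_spec c
  have hc : IsConj g l.prod := ConjClasses.mk_eq_mk_iff_isConj.mp (hg.trans hp.symm)
  rcases isCyclicallyReducible_prod l hl with ⟨x, hx, hcx⟩ | ⟨w, hw, hlw⟩
  · exact absurd (hh.of_isConj (hc.trans hcx)) (not_isHyperbolic_of_isLetter hx)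
  · refine ⟨w, isHyperbolic_toGam_mat.mp (hh.of_isConj (hc.trans hw)), ?_, by omega⟩
    rw [← hp, cls, ConjClasses.mk_eq_mk_iff_isConj]
    exact hw.symm

theorem Mixed.isClosedGeodesic {w : List Bool} (h : Mixed w) : IsClosedGeodesic (cls w) :=
  ⟨_, rfl, isHyperbolic_toGam_mat.mpr h⟩

theorem Mixed.classLength_cls {w : List Bool} (h : Mixed w) : classLength (cls w) = 2 * w.length := by
  refine le_antisymm (classLength_cls_le w) ?_
  obtain ⟨w', hw', he, hle⟩ := h.isClosedGeodesic.exists_word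
  rwa [((hw'.cls_eq_iff h).mp he).perm.length_eq] at hle

/-! ### Primitive geodesics -/

theorem PrimWord.mixed {w : List Bool} (h : PrimWord w) (hl : 2 ≤ w.length) : Mixed w := by
  by_contra hm
  have key : ∃ b, w = List.replicate w.length b := by
    by_cases ht : true ∈ w
    · exact ⟨true, List.eq_replicate_iff.mpr ⟨rfl, fun b hb => by
        cases b
        · exact absurd ⟨ht, hb⟩ hm
        · rfl⟩⟩
    · exact ⟨false, List.eq_replicate_iff.mpr ⟨rfl, fun b hb => by
        cases b
        · rfl
        · exact absurd hb ht⟩⟩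
  obtain ⟨b, hb⟩ := key
  refine h.2 1 one_pos (by omega) ?_
  rw [hb, List.rotate_replicate]

theorem Mixed.ne_nil {w : List Bool} (h : Mixed w) : w ≠ [] := List.ne_nil_of_mem h.1

theorem Mixed.primWord {w : List Bool} (h : Mixed w) {g : Gam} (hg : ConjClasses.mk g = cls w)
    (hp : IsPrimitive g) : PrimWord w := by
  by_contra hn
  obtain ⟨z, k, hk, rfl⟩ := exists_wordPow_of_not_primWord h.ne_nil hn
  rw [cls, ConjClasses.mk_eq_mk_iff_isConj, mat_wordPow, map_pow] at hg
  obtain ⟨c, hc⟩ := isConj_iff.mp hg.symm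
  refine hp (c * toGam (mat z) * c⁻¹) k hk ?_
  rw [conj_pow, hc]

theorem mat_ne_neg_mat (u v : List Bool) : mat u ≠ -mat v := by
  intro h
  have h1 := (one_le_diag_mat u).1
  have h2 := (one_le_diag_mat v).1
  rw [h] at h1
  simp at h1
  omega

theorem pow_eq_or_neg {M N : SL(2, ℤ)} (h : M = N ∨ M = -N) (k : ℕ) :
    M ^ k = N ^ k ∨ M ^ k = -N ^ k := by
  rcases h with rfl | rfl
  · exact Or.inl rfl
  · rw [neg_pow]
    rcases neg_one_pow_eq_or SL(2, ℤ) k with h | h <;> simp [h]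

/-- A `k`-th root `H` of `mat w` up to sign commutes with `mat w`, so `H * mat w ^ l` is, up to
sign, the matrix of a word `n` that commutes with `w`. Then `n` and `w` are powers `z^i`, `z^j` of
one word, and `k * i = (1 + l * k) * j` forces `k ∣ j`. So `w` is a proper power. -/
theorem PrimWord.isPrimitive {w : List Bool} (h : PrimWord w) (hm : Mixed w) :
    IsPrimitive (toGam (mat w)) := by
  intro g k hk hg
  obtain ⟨H, rfl⟩ := toGam_surjective g
  rw [← map_pow, toGam_eq_iff] at hg
  have hcomm : H * mat w = mat w * H := by
    have hc : H * H ^ k = H ^ k * H := (Commute.refl H).pow_right k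
    rcases hg with hg | hg
    · rwa [hg] at hc
    · rw [hg, mul_neg, neg_mul] at hc
      exact neg_injective hc
  obtain ⟨l, n, hn⟩ := exists_mat_eq_mul_pow hm.one_le_mat hm.one_le_mat hcomm
  have hcw : n ++ w = w ++ n := by
    apply mat_injective
    rw [mat_append, mat_append]
    have key : H * mat w ^ l * mat w = mat w * (H * mat w ^ l) := by
      rw [mul_assoc, ← pow_succ, pow_succ', ← mul_assoc, hcomm, mul_assoc]
    rcases hn with hn | hn
    · rw [hn, key]
    · rw [hn, neg_mul, key, mul_neg]
  have hpow : wordPow n k = wordPow w (1 + l * k) := by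
    have h1 : (H * mat w ^ l) ^ k = H ^ k * mat w ^ (l * k) := by
      rw [(show Commute H (mat w ^ l) from (show Commute H (mat w) from hcomm).pow_right l).mul_pow,
        ← pow_mul]
    have h2 : mat (wordPow n k) = mat (wordPow w (1 + l * k)) ∨
        mat (wordPow n k) = -mat (wordPow w (1 + l * k)) := by
      rw [mat_wordPow, mat_wordPow, pow_add, pow_one]
      rcases pow_eq_or_neg hn k with h3 | h3 <;> rw [h3, h1] <;> rcases hg with hg | hg <;> rw [hg] <;>
        simp
    exact mat_injective (h2.resolve_right (mat_ne_neg_mat _ _))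
  obtain ⟨z, i, j, hi, hj⟩ := exists_root_of_commute n w hcw
  have hlen := congrArg List.length hpow
  have hw := List.length_pos_iff.mpr h.1
  rw [length_wordPow, length_wordPow, hi, hj, length_wordPow, length_wordPow] at hlen
  rw [hj, length_wordPow] at hw
  have hz : 0 < z.length := Nat.pos_of_mul_pos_left hw
  have hj0 : 0 < j := Nat.pos_of_mul_pos_right hw
  have hij : k * i = (1 + l * k) * j := by
    apply Nat.eq_of_mul_eq_mul_right hz
    rw [mul_assoc, hlen, mul_assoc]
  have hdvd : k ∣ j := by
    have h1 : k ∣ j + k * (l * j) := ⟨i, by rw [hij]; ring⟩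
    exact (Nat.dvd_add_left ⟨_, rfl⟩).mp h1
  exact h.wordPow_ne z j (hk.trans (Nat.le_of_dvd hj0 hdvd)) hj.symm

theorem Mixed.isPrimitiveGeodesic_cls {w : List Bool} (h : Mixed w) :
    IsPrimitiveGeodesic (cls w) ↔ PrimWord w :=
  ⟨fun ⟨_, _, hg, hp⟩ => h.primWord hg hp,
    fun hp => ⟨h.isClosedGeodesic, _, rfl, hp.isPrimitive h⟩⟩

/-! ### Reciprocal geodesics -/

theorem toGam_mul_self_of_tr_eq_zero {M : SL(2, ℤ)} (h : tr M = 0) : toGam M * toGam M = 1 := by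
  rw [← map_mul, ← map_one toGam, toGam_eq_iff]
  right
  have hd := det_entries M
  have h' : M.1 1 1 = -M.1 0 0 := by rw [tr] at h; omega
  rw [h'] at hd
  apply sl_ext <;> simp [mul_entry, h'] <;> linarith

theorem tr_eq_zero_of_orderOf {M : SL(2, ℤ)} (h : orderOf (toGam M) = 2) : tr M = 0 := by
  have h1 : toGam (M * M) = toGam 1 := by
    rw [map_mul, map_one, ← pow_two]
    exact orderOf_dvd_iff_pow_eq_one.mp h.dvd
  have h2 : toGam M ≠ toGam 1 := by
    intro h0
    rw [h0, map_one, orderOf_one] at h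
    omega
  rw [Ne, toGam_eq_iff] at h2
  by_contra ht
  have hd := det_entries M
  -- The off-diagonal entries of the square are those of `M` times the trace. If the trace is not
  -- zero, `M` is diagonal and hence `1` or `-1`.
  have e01 : (M * M).1 0 1 = M.1 0 1 * tr M := by rw [mul_entry, tr]; ring
  have e10 : (M * M).1 1 0 = M.1 1 0 * tr M := by rw [mul_entry, tr]; ring
  have z01 : M.1 0 1 * tr M = 0 := by
    rw [← e01]; rcases toGam_eq_iff.mp h1 with h | h <;> rw [h] <;> simp
  have z10 : M.1 1 0 * tr M = 0 := by
    rw [← e10]; rcases toGam_eq_iff.mp h1 with h | h <;> rw [h] <;> simp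
  have z01' := (mul_eq_zero.mp z01).resolve_right ht
  have z10' := (mul_eq_zero.mp z10).resolve_right ht
  rw [z01', z10'] at hd
  rcases Int.mul_eq_one_iff_eq_one_or_neg_one.mp (by linarith : M.1 0 0 * M.1 1 1 = 1) with
    ⟨h3, h4⟩ | ⟨h3, h4⟩
  · exact h2 (Or.inl (by apply sl_ext <;> simp [z01', z10', h3, h4]))
  · exact h2 (Or.inr (by apply sl_ext <;> simp [z01', z10', h3, h4]))

/-- The equation of the axis of a matrix. -/
def axisForm (M : SL(2, ℤ)) (z : ℍ) : ℝ :=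
  (M.1 1 0 : ℝ) * (z.re ^ 2 + z.im ^ 2) + ((M.1 1 1 : ℝ) - (M.1 0 0 : ℝ)) * z.re - (M.1 0 1 : ℝ)

theorem mem_axis_iff {g : Gam} {z : ℍ} : z ∈ axis g ↔ ∃ M, toGam M = g ∧ axisForm M z = 0 :=
  Iff.rfl

theorem smul_equations (M : SL(2, ℤ)) (z : ℍ) :
    (M • z).re * (M.1 1 0 * z.re + M.1 1 1) - (M • z).im * (M.1 1 0 * z.im) =
      M.1 0 0 * z.re + M.1 0 1 ∧
    (M • z).re * (M.1 1 0 * z.im) + (M • z).im * (M.1 1 0 * z.re + M.1 1 1) = M.1 0 0 * z.im := by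
  have h := UpperHalfPlane.coe_specialLinearGroup_apply M z
  have hne : (M.1 1 0 : ℂ) * z + (M.1 1 1 : ℂ) ≠ 0 := by
    intro h0
    have him := congrArg Complex.im h0
    have hre := congrArg Complex.re h0
    simp at him hre
    rcases him with him | him
    · rw [him] at hre
      simp at hre
      have := det_entries M
      simp [him, hre] at this
    · exact z.im_ne_zero him
  simp only [eq_intCast, Complex.ofReal_intCast] at h
  rw [eq_div_iff hne] at h
  have hre := congrArg Complex.re h
  have him := congrArg Complex.im h
  simp only [Complex.mul_re, Complex.mul_im, Complex.add_re, Complex.add_im, Complex.intCast_re,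
    Complex.intCast_im, UpperHalfPlane.coe_re, UpperHalfPlane.coe_im] at hre him
  exact ⟨by linarith, by linarith⟩

/-- The half turn `M` about `z` has trace zero, and its entries are determined by `z` up to a common
factor. The equation of the axis of `G` at `z` then yields `tr (M * G) = 0`. So `M` and `M * G` are
both involutions in the quotient, and `M` conjugates `G` to its inverse. -/
theorem isConj_inv_of_isOrderTwoPoint {G : SL(2, ℤ)} {z : ℍ} (hz : axisForm G z = 0)
    (h2 : IsOrderTwoPoint z) : IsConj (toGam G) (toGam G)⁻¹ := by
  obtain ⟨M, hM, hfix⟩ := h2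
  have ht := tr_eq_zero_of_orderOf hM
  obtain ⟨h1, h2⟩ := smul_equations M z
  rw [hfix] at h1 h2
  have him := z.im_pos
  have hs : M.1 1 1 = -M.1 0 0 := by rw [tr] at ht; omega
  have e1 : (M.1 0 0 : ℝ) = M.1 1 0 * z.re := by
    rw [hs] at h2
    push_cast at h2
    have : z.im * (M.1 0 0 : ℝ) = z.im * (M.1 1 0 * z.re) := by linarith
    exact mul_left_cancel₀ him.ne' this
  have e2 : (M.1 0 1 : ℝ) = - (M.1 1 0 * (z.re ^ 2 + z.im ^ 2)) := by
    rw [hs] at h1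
    push_cast at h1
    linear_combination -h1 - 2 * z.re * e1
  have htr : tr (M * G) = 0 := by
    have : (tr (M * G) : ℝ) = 0 := by
      rw [tr, mul_entry, mul_entry, hs]
      push_cast
      rw [e1, e2]
      rw [axisForm] at hz
      linear_combination -(M.1 1 0 : ℝ) * hz
    exact_mod_cast this
  have hMM := toGam_mul_self_of_tr_eq_zero ht
  have hMG := toGam_mul_self_of_tr_eq_zero htr
  rw [map_mul] at hMG
  refine isConj_iff.mpr ⟨toGam M, ?_⟩
  rw [inv_eq_of_mul_eq_one_left hMM]
  exact eq_inv_of_mul_eq_one_left (by rw [mul_assoc, hMG])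

/-- In SL(2), conjugation by the quarter turn matrix `matA` takes the inverse to the transpose. -/
theorem isConj_inv_dual (w : List Bool) : IsConj (toGam (mat w))⁻¹ (toGam (mat (dual w))) := by
  rw [← map_inv, isConj_toGam_iff]
  refine ⟨matA, Or.inl ?_⟩
  rw [eq_comm, ← mul_inv_eq_iff_eq_mul]
  apply sl_ext <;> simp [mul_entry, mat_dual, coe_matA] <;>
    linarith [det_entries (mat w)]

theorem Mixed.exists_dual_eq {w : List Bool} (h : Mixed w) (hr : IsReciprocal (cls w)) :
    ∃ w', w ~r w' ∧ dual w' = w' := by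
  obtain ⟨g, hg, -, z, hz, hz2⟩ := hr
  obtain ⟨G, rfl, hG⟩ := mem_axis_iff.mp hz
  have hc := ConjClasses.mk_eq_mk_iff_isConj.mp hg
  have h1 := isConj_inv_of_isOrderTwoPoint hG hz2
  have h2 : IsConj (toGam G)⁻¹ (toGam (mat w))⁻¹ := by
    obtain ⟨c, hc⟩ := isConj_iff.mp hc
    exact isConj_iff.mpr ⟨c, by rw [← hc]; group⟩
  exact exists_dual_eq_of_isRotated (h.isRotated_of_isConj h.mixed_dual
    (hc.symm.trans (h1.trans (h2.trans (isConj_inv_dual w)))))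

theorem isOrderTwoPoint_I : IsOrderTwoPoint UpperHalfPlane.I := by
  refine ⟨matA, ?_, ?_⟩
  · apply orderOf_eq_prime
    · rw [pow_two]; exact genA_mul_genA
    · rw [mk_eq_toGam, ← map_one toGam, Ne, toGam_eq_iff]
      rintro (h | h) <;>
      · have := congrArg (fun M : SL(2, ℤ) => M.1 0 1) h
        simp [coe_matA] at this
  · apply UpperHalfPlane.ext
    have := UpperHalfPlane.modular_S_smul UpperHalfPlane.I
    rw [show ModularGroup.S = matA from rfl] at this
    rw [this]
    simp

/-- The matrix of a self-dual word is symmetric, so its axis passes through `i`, the fixed point of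
`a`. -/
theorem Mixed.isReciprocal {w : List Bool} (h : Mixed w) (hs : dual w = w) :
    IsReciprocal (cls w) := by
  refine ⟨_, rfl, isHyperbolic_toGam_mat.mpr h, UpperHalfPlane.I, ?_, isOrderTwoPoint_I⟩
  refine mem_axis_iff.mpr ⟨mat w, rfl, ?_⟩
  have := mat_dual w 0 1
  rw [hs] at this
  simp [axisForm, this]

theorem Mixed.isReciprocal_cls {w : List Bool} (h : Mixed w) :
    IsReciprocal (cls w) ↔ ∃ w', w ~r w' ∧ dual w' = w' := by
  refine ⟨h.exists_dual_eq, ?_⟩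
  rintro ⟨w', hw, hs⟩
  rw [cls_eq_of_isRotated hw]
  exact (h.of_isRotated hw).isReciprocal hs

/-! ### Heights of axes -/

/-- Equivariance of axes. With the denominator `D = |r z + s|²` of the Möbius map cleared, both
sides are polynomial and differ by the squared determinant. -/
theorem axisForm_conj (M G : SL(2, ℤ)) (z : ℍ) (hz : axisForm G z = 0) :
    axisForm (M * G * M⁻¹) (M • z) = 0 := by
  obtain ⟨h1, h2⟩ := smul_equations M z
  have hd : (M.1 0 0 : ℝ) * M.1 1 1 - M.1 0 1 * M.1 1 0 = 1 := by exact_mod_cast det_entries M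
  have him := z.im_pos
  set x := z.re
  set y := z.im
  set x' := (M • z).re
  set y' := (M • z).im
  set p : ℝ := (M.1 0 0 : ℝ) with hp
  set q : ℝ := (M.1 0 1 : ℝ) with hq
  set r : ℝ := (M.1 1 0 : ℝ) with hr
  set s : ℝ := (M.1 1 1 : ℝ) with hs'
  set D := (r * x + s) ^ 2 + (r * y) ^ 2 with hD
  have hD0 : D ≠ 0 := by
    intro h0
    have h3 : r * x + s = 0 := by nlinarith [sq_nonneg (r * x + s), sq_nonneg (r * y)]
    have h4 : r * y = 0 := by nlinarith [sq_nonneg (r * x + s), sq_nonneg (r * y)]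
    have h5 : r = 0 := (mul_eq_zero.mp h4).resolve_right him.ne'
    rw [h5] at h3 hd
    have h6 : s = 0 := by linarith
    rw [h6] at hd
    simp at hd
  have hn : (x' ^ 2 + y' ^ 2) * D = (p * x + q) ^ 2 + (p * y) ^ 2 := by
    rw [← h1, ← h2]; ring
  have hx : x' * D = (p * x + q) * (r * x + s) + (p * y) * (r * y) := by
    rw [← h1, ← h2]; ring
  apply mul_right_cancel₀ hD0
  rw [zero_mul]
  have e : axisForm (M * G * M⁻¹) (M • z) * D =
      ((M * G * M⁻¹).1 1 0 : ℝ) * ((x' ^ 2 + y' ^ 2) * D) +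
      (((M * G * M⁻¹).1 1 1 : ℝ) - ((M * G * M⁻¹).1 0 0 : ℝ)) * (x' * D) -
      ((M * G * M⁻¹).1 0 1 : ℝ) * D := by
    rw [axisForm]; ring
  rw [e, hn, hx]
  rw [axisForm] at hz
  simp only [mul_entry, Matrix.SpecialLinearGroup.coe_inv, Matrix.adjugate_fin_two]
  simp only [Matrix.of_apply, Matrix.cons_val', Matrix.cons_val_zero, Matrix.cons_val_one,
    Matrix.cons_val_fin_one]
  push_cast
  rw [← hp, ← hq, ← hr, ← hs', hD]
  linear_combination (p * s - q * r) ^ 2 * hz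

theorem mat_replicate_true_mul (m : ℕ) (N : SL(2, ℤ)) (j : Fin 2) :
    (mat (List.replicate m true) * N).1 0 j = N.1 0 j + m * N.1 1 j ∧
      (mat (List.replicate m true) * N).1 1 j = N.1 1 j := by
  induction m with
  | zero => simp
  | succ m ih =>
    rw [List.replicate_succ, mat_cons, mul_assoc]
    obtain ⟨h1, h2⟩ := letterMat_true_mul (mat (List.replicate m true) * N) j
    rw [h1, h2, ih.1, ih.2]
    push_cast
    exact ⟨by ring, rfl⟩

/-- A positive matrix whose larger fixed point exceeds `m` is the matrix of a word that starts
with `m` equal letters. -/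
theorem exists_mat_replicate_append {K : SL(2, ℤ)} (hK : ∀ i j, 1 ≤ K.1 i j) (m : ℕ)
    (h : K.1 1 0 * (m : ℤ) ^ 2 + (K.1 1 1 - K.1 0 0) * m - K.1 0 1 < 0) :
    ∃ n, mat (List.replicate m true ++ n) = K := by
  have h0 := mat_replicate_true_mul m ((mat (List.replicate m true))⁻¹ * K) 0
  have h1 := mat_replicate_true_mul m ((mat (List.replicate m true))⁻¹ * K) 1
  have hd := det_entries ((mat (List.replicate m true))⁻¹ * K)
  rw [mul_inv_cancel_left] at h0 h1
  set N := (mat (List.replicate m true))⁻¹ * K with hN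
  have k10 := hK 1 0
  have k11 := hK 1 1
  rw [h0.1, h0.2, h1.1, h1.2] at h
  rw [h0.2] at k10
  rw [h1.2] at k11
  -- The quadratic form at `m` equals `-(N₀₀ m + N₀₁)` for `N = T^(-m) K`. Together with determinant
  -- one and a positive second row, its sign makes the first row nonnegative.
  have hpos : 0 < N.1 0 0 * m + N.1 0 1 := by linarith
  have n00 : 0 ≤ N.1 0 0 := by
    by_contra hcon
    have h2 : N.1 0 1 < 0 := by nlinarith
    have hm : (0 : ℤ) ≤ m := Int.natCast_nonneg m
    nlinarith
  have n01 : 0 ≤ N.1 0 1 := by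
    by_contra hcon
    have h2 : N.1 0 0 = 0 := by
      by_contra h3
      have h4 : 1 ≤ N.1 0 0 := by omega
      nlinarith
    rw [h2] at hpos
    omega
  obtain ⟨n, hn⟩ := (isNonneg_of_entries n00 n01 (by omega) (by omega)).exists_mat
  exact ⟨n, by rw [mat_append, hn, hN, mul_inv_cancel_left]⟩

theorem CyclicRunsLE.not_isRotated {r : ℕ} {w : List Bool} (h : CyclicRunsLE r w)
    (n : List Bool) : ¬ w ~r (List.replicate (r + 1) true ++ n) := fun hw =>
  h.runsLE_of_isRotated hw true (List.prefix_append _ _).isInfix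

/-- A matrix in the class of a word with bounded cyclic runs does not have fixed points on both
sides of the interval from `0` to `m`. -/
theorem CyclicRunsLE.not_separating {r : ℕ} {w : List Bool} (hm : Mixed w) (hr : CyclicRunsLE r w)
    {G : SL(2, ℤ)} (hG : IsConj (toGam (mat w)) (toGam G)) (h0 : 0 < G.1 1 0 * G.1 0 1)
    (hf : G.1 1 0 * (G.1 1 0 * ((r + 1 : ℕ) : ℤ) ^ 2 +
      (G.1 1 1 - G.1 0 0) * ((r + 1 : ℕ) : ℤ) - G.1 0 1) < 0) : False := by
  wlog ht : 0 < tr G generalizing G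
  · refine this (G := -G) (by rwa [toGam_neg]) (by simpa using h0) (by simp at hf ⊢; linarith) ?_
    have h1 := abs_tr_of_isConj hG
    have h2 := hm.three_le_tr
    have h3 : tr G ≠ 0 := by
      rintro h4
      rw [h4, abs_zero, abs_eq_zero] at h1
      omega
    rw [tr_neg]
    omega
  have hd := det_entries G
  have had : 0 < G.1 0 0 * G.1 1 1 := by nlinarith
  rw [tr] at ht
  have ha : 0 < G.1 0 0 := by
    rcases mul_pos_iff.mp had with h | h
    · exact h.1
    · omega
  have hd' : 0 < G.1 1 1 := pos_of_mul_pos_right had ha.le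
  have hmix : ∀ n, 2 < |tr (mat n)| → Mixed n := fun n hn =>
    isHyperbolic_toGam_mat.mp (isHyperbolic_toGam.mpr hn)
  have htr : 2 < |tr G| := by
    rw [← abs_tr_of_isConj hG]
    have h2 := hm.three_le_tr
    rw [abs_of_nonneg (by omega)]
    omega
  rcases lt_or_ge 0 (G.1 1 0) with hc | hc
  · have hb : 0 < G.1 0 1 := pos_of_mul_pos_right h0 hc.le
    obtain ⟨n, hn⟩ := exists_mat_replicate_append (K := G)
      (by intro i j; fin_cases i <;> fin_cases j <;> assumption) (r + 1)
      (neg_of_mul_neg_right hf hc.le)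
    rw [← hn] at hG htr
    exact hr.not_isRotated n (hm.isRotated_of_isConj (hmix _ htr) hG)
  -- The axis has the opposite orientation: now `G⁻¹` is the positive matrix, and its class belongs
  -- to `dual w`, whose cyclic runs obey the same bound.
  · have hc' : G.1 1 0 < 0 := lt_of_le_of_ne hc (by rintro h; simp [h] at h0)
    have hb : G.1 0 1 < 0 := neg_of_mul_pos_right h0 hc
    have e00 : (G⁻¹).1 0 0 = G.1 1 1 := by simp [Matrix.adjugate_fin_two]
    have e01 : (G⁻¹).1 0 1 = -G.1 0 1 := by simp [Matrix.adjugate_fin_two]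
    have e10 : (G⁻¹).1 1 0 = -G.1 1 0 := by simp [Matrix.adjugate_fin_two]
    have e11 : (G⁻¹).1 1 1 = G.1 0 0 := by simp [Matrix.adjugate_fin_two]
    have hpos := pos_of_mul_neg_right hf hc
    obtain ⟨n, hn⟩ := exists_mat_replicate_append (K := G⁻¹)
      (by
        intro i j
        fin_cases i <;> fin_cases j
        · show 1 ≤ (G⁻¹).1 0 0
          omega
        · show 1 ≤ (G⁻¹).1 0 1
          omega
        · show 1 ≤ (G⁻¹).1 1 0
          omega
        · show 1 ≤ (G⁻¹).1 1 1
          omega) (r + 1)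
      (by rw [e00, e01, e10, e11]; linarith)
    have hti : tr G⁻¹ = tr G := by rw [tr, e00, e11, tr, add_comm]
    rw [← hti, ← hn] at htr
    refine hr.cyclicRunsLE_dual.not_isRotated n (hm.mixed_dual.isRotated_of_isConj (hmix _ htr) ?_)
    rw [hn, map_inv]
    refine (isConj_inv_dual w).symm.trans ?_
    obtain ⟨c, hc⟩ := isConj_iff.mp hG
    exact isConj_iff.mpr ⟨c, by rw [← hc]; group⟩

/-- The translation by `s`. -/
def transl (s : ℤ) : SL(2, ℤ) := ⟨!![1, s; 0, 1], by simp⟩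

theorem coe_transl (s : ℤ) : (transl s).1 = !![1, s; 0, 1] := rfl

theorem CyclicRunsLE.im_le {r : ℕ} {w : List Bool} (hm : Mixed w) (hr : CyclicRunsLE r w)
    {G : SL(2, ℤ)} (hG : IsConj (toGam (mat w)) (toGam G)) {z : ℍ} (hz : axisForm G z = 0) :
    z.im ≤ (((r + 1 : ℕ) : ℝ) + 1) / 2 := by
  by_contra hcon
  rw [not_le] at hcon
  have hc : G.1 1 0 ≠ 0 := by
    intro h0
    have hd := det_entries G
    have h1 := abs_tr_of_isConj hG
    have h2 := hm.three_le_tr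
    rw [h0, mul_zero, sub_zero] at hd
    rcases Int.mul_eq_one_iff_eq_one_or_neg_one.mp hd with ⟨h3, h4⟩ | ⟨h3, h4⟩ <;>
    · rw [abs_of_nonneg (by omega), tr, tr, h3, h4] at h1
      rw [tr] at h2
      norm_num at h1
      omega
  set m : ℕ := r + 1 with hmdef
  have hm1 : (1 : ℝ) ≤ m := by rw [hmdef]; push_cast; linarith [(Nat.cast_nonneg r : (0 : ℝ) ≤ r)]
  have hc' : (G.1 1 0 : ℝ) ≠ 0 := by exact_mod_cast hc
  set a : ℝ := (G.1 0 0 : ℝ) with ha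
  set b : ℝ := (G.1 0 1 : ℝ) with hb
  set c : ℝ := (G.1 1 0 : ℝ) with hcdef
  set d : ℝ := (G.1 1 1 : ℝ) with hd
  set x₀ : ℝ := (a - d) / (2 * c) with hx₀
  have hax : a - d = 2 * c * x₀ := by rw [hx₀]; field_simp
  rw [axisForm] at hz
  -- The axis is a half circle with centre `x₀` and radius at least `z.im`, so every integer within
  -- distance `(m + 1) / 2` of `x₀` lies strictly between the two fixed points.
  have key : ∀ t : ℤ, |(t : ℝ) - x₀| ≤ ((m : ℝ) + 1) / 2 →
      G.1 1 0 * (G.1 1 0 * t ^ 2 + (G.1 1 1 - G.1 0 0) * t - G.1 0 1) < 0 := by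
    intro t ht
    have h1 : ((G.1 1 0 * (G.1 1 0 * t ^ 2 + (G.1 1 1 - G.1 0 0) * t - G.1 0 1) : ℤ) : ℝ) =
        c ^ 2 * (((t : ℝ) - x₀) ^ 2 - ((z.re - x₀) ^ 2 + z.im ^ 2)) := by
      push_cast
      rw [← ha, ← hb, ← hcdef, ← hd] at *
      linear_combination c * hz - (c * (t : ℝ) - c * z.re) * hax
    have h2 : ((t : ℝ) - x₀) ^ 2 < z.im ^ 2 := by
      rw [← sq_abs]
      exact pow_lt_pow_left₀ (ht.trans_lt hcon) (abs_nonneg _) two_ne_zero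
    have h3 : 0 < c ^ 2 := by positivity
    have h4 : ((G.1 1 0 * (G.1 1 0 * t ^ 2 + (G.1 1 1 - G.1 0 0) * t - G.1 0 1) : ℤ) : ℝ) < 0 := by
      rw [h1]
      exact mul_neg_of_pos_of_neg h3 (by nlinarith [sq_nonneg (z.re - x₀)])
    exact_mod_cast h4
  -- An interval of length `m + 1` contains integers `s` and `s + m`. The translation by `-s` moves
  -- them to `0` and `m`.
  set s : ℤ := ⌈x₀ - ((m : ℝ) + 1) / 2⌉ with hs
  have hs1 := Int.le_ceil (x₀ - ((m : ℝ) + 1) / 2)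
  have hs2 := Int.ceil_lt_add_one (x₀ - ((m : ℝ) + 1) / 2)
  rw [← hs] at hs1 hs2
  have k1 := key s (abs_le.mpr ⟨by linarith, by linarith⟩)
  have k2 := key (s + m) (by push_cast; exact abs_le.mpr ⟨by linarith, by linarith⟩)
  refine CyclicRunsLE.not_separating (G := transl (-s) * G * transl s) hm hr ?_ ?_ ?_
  · refine hG.trans (isConj_iff.mpr ⟨toGam (transl (-s)), ?_⟩)
    have : transl s = (transl (-s))⁻¹ := by
      apply sl_ext <;> simp [coe_transl, Matrix.adjugate_fin_two]
    rw [this, map_mul, map_mul, map_inv]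
  · simp [mul_entry, coe_transl]
    nlinarith
  · rw [← hmdef]
    simp [mul_entry, coe_transl]
    nlinarith

theorem mem_axis_smul {g : Gam} {z : ℍ} (hz : z ∈ axis g) (M : SL(2, ℤ)) :
    M • z ∈ axis (toGam M * g * (toGam M)⁻¹) := by
  obtain ⟨G, rfl, hG⟩ := mem_axis_iff.mp hz
  exact mem_axis_iff.mpr ⟨M * G * M⁻¹, by simp, axisForm_conj M G z hG⟩

/-- A closed geodesic whose word has bounded cyclic runs lies in a thick part. -/
theorem CyclicRunsLE.carrier_subset {r : ℕ} {w : List Bool} (hm : Mixed w)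
    (hr : CyclicRunsLE r w) : carrier (cls w) ⊆ thickPart (r + 1) := by
  rintro p ⟨g, hg, z, hz, rfl⟩ z' hz' hi
  obtain ⟨M, rfl⟩ : z' ∈ MulAction.orbit SL(2, ℤ) z := MulAction.orbitRel_apply.mp (Quotient.exact hz')
  obtain ⟨G, hG, hax⟩ := mem_axis_iff.mp (mem_axis_smul hz M)
  refine Real.log_le_log (by linarith) (CyclicRunsLE.im_le hm hr (G := G) ?_ hax)
  rw [hG]
  exact (ConjClasses.mk_eq_mk_iff_isConj.mp hg).symm.trans (isConj_iff.mpr ⟨_, rfl⟩)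

/-! ### Counting words -/

/-- The words of length `n`. -/
def words (n : ℕ) : Finset (List Bool) := (List.finite_length_eq Bool n).toFinset

@[simp] theorem mem_words {n : ℕ} {w : List Bool} : w ∈ words n ↔ w.length = n := by simp [words]

@[simp] theorem card_words (n : ℕ) : (words n).card = 2 ^ n := by
  have h := card_vector (α := Bool) n
  rw [Fintype.card_bool] at h
  rw [← h, ← Fintype.card_coe]
  exact Fintype.card_congr (Equiv.subtypeEquivRight fun w => mem_words)

theorem sum_two_pow_lt (n : ℕ) : ∑ d ∈ Finset.range (n + 1), 2 ^ d < 2 * 2 ^ n := by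
  rw [Nat.geomSum_eq le_rfl, pow_succ]
  have := Nat.two_pow_pos n
  omega

open Classical in
/-- Most words are primitive. -/
theorem card_le_card_filter_primWord {n : ℕ} (hn : 1 ≤ n) {A : Finset (List Bool)}
    (hA : A ⊆ words n) : A.card ≤ (A.filter PrimWord).card + 2 * 2 ^ (n / 2) := by
  -- A nonprimitive word is determined by its root, whose length `d` is at most `n / 2`; there are
  -- `2 ^ d` candidates.
  have hsub : A.filter (fun w => ¬ PrimWord w) ⊆ (Finset.range (n / 2 + 1)).biUnion fun d =>
      (words d).image fun z => wordPow z (n / d) := by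
    intro w hw
    obtain ⟨hwA, hp⟩ := Finset.mem_filter.mp hw
    have hl := mem_words.mp (hA hwA)
    obtain ⟨z, k, hk, rfl⟩ := exists_wordPow_of_not_primWord
      (List.length_pos_iff.mp (by omega)) hp
    rw [length_wordPow] at hl
    have hz : 0 < z.length := Nat.pos_of_ne_zero fun h => by rw [h] at hl; omega
    refine Finset.mem_biUnion.mpr ⟨z.length, ?_, Finset.mem_image.mpr ⟨z, by simp, ?_⟩⟩
    · rw [Finset.mem_range, Nat.lt_succ_iff, Nat.le_div_iff_mul_le two_pos, mul_comm, ← hl]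
      exact Nat.mul_le_mul_right _ hk
    · rw [← hl, Nat.mul_div_cancel _ hz]
  have h1 := Finset.card_le_card hsub
  have h2 : ((Finset.range (n / 2 + 1)).biUnion fun d =>
      (words d).image fun z => wordPow z (n / d)).card ≤ ∑ d ∈ Finset.range (n / 2 + 1), 2 ^ d :=
    Finset.card_biUnion_le.trans (Finset.sum_le_sum fun d _ =>
      Finset.card_image_le.trans (card_words d).le)
  have h3 := sum_two_pow_lt (n / 2)
  rw [← Finset.card_filter_add_card_filter_not (s := A) PrimWord]
  omega

theorem append_dual_injective : Function.Injective fun x : List Bool => x ++ dual x := by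
  intro x y h
  have hl := congrArg List.length h
  simp only [List.length_append, length_dual] at hl
  exact (List.append_inj h (by omega)).1

open Classical in
/-- Most words fixed by `dual` are primitive. -/
theorem card_le_card_filter_primWord_of_dual {k : ℕ} (hk : 1 ≤ k) {A : Finset (List Bool)}
    (hA : ∀ w ∈ A, w.length = 2 * k ∧ dual w = w) :
    A.card ≤ (A.filter PrimWord).card + 2 * 2 ^ (k / 2) := by
  have hsub : A.filter (fun w => ¬ PrimWord w) ⊆ (Finset.range (k / 2 + 1)).biUnion fun d =>
      (words d).image fun x => wordPow (x ++ dual x) (k / d) := by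
    intro w hw
    obtain ⟨hwA, hp⟩ := Finset.mem_filter.mp hw
    obtain ⟨hl, hd⟩ := hA w hwA
    obtain ⟨z, j, hj, rfl⟩ := exists_wordPow_of_not_primWord
      (List.length_pos_iff.mp (by omega)) hp
    -- The root of a self-dual word is itself self-dual, so half of it suffices to describe the
    -- word.
    have hz : dual z = z := by
      rw [dual_wordPow] at hd
      obtain ⟨j, rfl⟩ := Nat.exists_eq_add_of_le' (by omega : 1 ≤ j)
      rw [wordPow_succ, wordPow_succ] at hd
      exact (List.append_inj hd (by simp)).1
    obtain ⟨x, rfl⟩ := exists_eq_append_dual hz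
    rw [length_wordPow, List.length_append, length_dual] at hl
    have hl' : j * x.length = k := by linarith
    have hx : 0 < x.length := Nat.pos_of_ne_zero fun h => by rw [h] at hl'; omega
    refine Finset.mem_biUnion.mpr ⟨x.length, ?_, Finset.mem_image.mpr ⟨x, by simp, ?_⟩⟩
    · rw [Finset.mem_range, Nat.lt_succ_iff, Nat.le_div_iff_mul_le two_pos, mul_comm, ← hl']
      exact Nat.mul_le_mul_right _ hj
    · rw [← hl', Nat.mul_div_cancel _ hx]
  have h1 := Finset.card_le_card hsub
  have h2 : ((Finset.range (k / 2 + 1)).biUnion fun d =>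
      (words d).image fun x => wordPow (x ++ dual x) (k / d)).card ≤
      ∑ d ∈ Finset.range (k / 2 + 1), 2 ^ d :=
    Finset.card_biUnion_le.trans (Finset.sum_le_sum fun d _ =>
      Finset.card_image_le.trans (card_words d).le)
  have h3 := sum_two_pow_lt (k / 2)
  rw [← Finset.card_filter_add_card_filter_not (s := A) PrimWord]
  omega

/-! ### Growth of the number of words with bounded runs -/

open Classical in
/-- The words of length `k` whose runs have length at most `r`. -/
def runWords (r k : ℕ) : Finset (List Bool) := (words k).filter (RunsLE r)

theorem mem_runWords {r k : ℕ} {w : List Bool} :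
    w ∈ runWords r k ↔ w.length = k ∧ RunsLE r w := by simp [runWords]

/-- The words of length `k + 1` obtained from words with bounded runs. -/
theorem two_mul_card_runWords (r k : ℕ) : 2 * (runWords r k).card ≤ (runWords r (k + 1)).card +
    if r ≤ k then 2 * (runWords r (k - r)).card else 0 := by
  classical
  set S := ((Finset.univ : Finset Bool) ×ˢ runWords r k).image fun p => p.1 :: p.2 with hS
  set T := ((Finset.univ : Finset Bool) ×ˢ runWords r (k - r)).image
    fun p => List.replicate (r + 1) p.1 ++ p.2 with hT
  have hcS : S.card = 2 * (runWords r k).card := by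
    rw [hS, Finset.card_image_of_injective, Finset.card_product]
    · simp
    · rintro ⟨a, x⟩ ⟨b, y⟩ h
      simpa using h
  have hcT : T.card ≤ 2 * (runWords r (k - r)).card :=
    Finset.card_image_le.trans (by rw [Finset.card_product]; simp)
  have hmem : ∀ v ∈ S, v ∈ runWords r (k + 1) ∨ (r ≤ k ∧ v ∈ T) := by
    intro v hv
    obtain ⟨⟨b, x⟩, hx, rfl⟩ := Finset.mem_image.mp hv
    obtain ⟨hl, hr⟩ := mem_runWords.mp (Finset.mem_product.mp hx).2
    simp only at hl hr ⊢
    by_cases h : RunsLE r (b :: x)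
    · exact Or.inl (mem_runWords.mpr ⟨by simp [hl], h⟩)
    · right
      simp only [RunsLE, not_forall, not_not] at h
      obtain ⟨c, hc⟩ := h
      -- A forbidden run can only be a prefix that contains the new letter. It has exactly `r + 1`
      -- letters, and removing it leaves a word of length `k - r` with bounded runs.
      rcases List.infix_cons_iff.mp hc with hc | hc
      · obtain ⟨y, hy⟩ := hc
        have hlen := congrArg List.length hy
        simp only [List.length_append, List.length_replicate, List.length_cons, hl] at hlen
        refine ⟨by omega, Finset.mem_image.mpr ⟨(c, y), Finset.mem_product.mpr
          ⟨Finset.mem_univ _, mem_runWords.mpr ⟨by simp; omega, hr.of_infix ?_⟩⟩, hy⟩⟩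
        rw [List.replicate_succ, List.cons_append, List.cons.injEq] at hy
        rw [← hy.2]
        exact (List.suffix_append _ _).isInfix
      · exact absurd hc (hr c)
  rw [← hcS]
  split_ifs with hrk
  · calc S.card ≤ (runWords r (k + 1) ∪ T).card := Finset.card_le_card fun v hv =>
          Finset.mem_union.mpr ((hmem v hv).imp_right And.right)
      _ ≤ _ := (Finset.card_union_le _ _).trans (by omega)
  · rw [add_zero]
    exact Finset.card_le_card fun v hv => (hmem v hv).resolve_right fun h => hrk h.1

/-- With `a k` for the counts, the recursion is `a (k+1) ≥ 2 a k - 2 a (k-r)`, and `a k ≥ lam^r a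
(k-r)` by induction. The condition on `lam` lets `(2 - lam) a k` absorb the subtracted term. -/
theorem mul_card_runWords_le {r : ℕ} {lam : ℝ} (h1 : 0 ≤ lam) (h2 : lam ≤ 2)
    (h : 2 ≤ (2 - lam) * lam ^ r) (k : ℕ) :
    lam * (runWords r k).card ≤ ((runWords r (k + 1)).card : ℝ) := by
  induction k using Nat.strong_induction_on with
  | _ k ih =>
    have hk := two_mul_card_runWords r k
    by_cases hrk : r ≤ k
    · rw [if_pos hrk] at hk
      have hk' : 2 * ((runWords r k).card : ℝ) ≤ (runWords r (k + 1)).card +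
          2 * (runWords r (k - r)).card := by exact_mod_cast hk
      have hpow : ∀ j ≤ r, lam ^ j * (runWords r (k - r)).card ≤
          ((runWords r (k - r + j)).card : ℝ) := by
        intro j hj
        induction j with
        | zero => simp
        | succ j ihj =>
          calc lam ^ (j + 1) * (runWords r (k - r)).card
              = lam * (lam ^ j * (runWords r (k - r)).card) := by ring
            _ ≤ lam * (runWords r (k - r + j)).card :=
                mul_le_mul_of_nonneg_left (ihj (by omega)) h1
            _ ≤ _ := ih _ (by omega)
      have hr := hpow r le_rfl
      rw [Nat.sub_add_cancel hrk] at hr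
      have h3 := mul_le_mul_of_nonneg_left hr (sub_nonneg.mpr h2)
      have h4 : 2 * ((runWords r (k - r)).card : ℝ) ≤
          (2 - lam) * lam ^ r * (runWords r (k - r)).card :=
        mul_le_mul_of_nonneg_right h (Nat.cast_nonneg _)
      linarith
    · rw [if_neg hrk, add_zero] at hk
      have hk' : 2 * ((runWords r k).card : ℝ) ≤ (runWords r (k + 1)).card := by exact_mod_cast hk
      exact (mul_le_mul_of_nonneg_right h2 (Nat.cast_nonneg _)).trans hk'

/-- Exponential lower bound for the number of words with bounded runs. -/
theorem pow_le_card_runWords {r : ℕ} {lam : ℝ} (h1 : 0 ≤ lam) (h2 : lam ≤ 2)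
    (h : 2 ≤ (2 - lam) * lam ^ r) (k : ℕ) : lam ^ k ≤ ((runWords r k).card : ℝ) := by
  induction k with
  | zero =>
    have : [] ∈ runWords r 0 := mem_runWords.mpr ⟨rfl, fun b hb => by
      have := hb.length_le
      simp at this⟩
    rw [pow_zero]
    exact_mod_cast Finset.card_pos.mpr ⟨_, this⟩
  | succ k ih =>
    rw [pow_succ']
    exact (mul_le_mul_of_nonneg_left ih h1).trans (mul_card_runWords_le h1 h2 h k)

/-! ### Counting geodesics -/

open Classical in
/-- The geodesics of a set of words. -/
def geodesics (A : Finset (List Bool)) : Finset (ConjClasses Gam) := A.image cls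

theorem mem_geodesics {A : Finset (List Bool)} {c : ConjClasses Gam} :
    c ∈ geodesics A ↔ ∃ w ∈ A, cls w = c := by simp [geodesics]

open Classical in
theorem card_biUnion_geodesics (s : Finset ℕ) (len : ℕ → ℕ) (hlen : Function.Injective len)
    (A : ℕ → Finset (List Bool)) (hA : ∀ k ∈ s, ∀ w ∈ A k, Mixed w ∧ w.length = len k) :
    (s.biUnion fun k => geodesics (A k)).card = ∑ k ∈ s, (geodesics (A k)).card := by
  refine Finset.card_biUnion fun i hi j hj hij => ?_
  refine Finset.disjoint_left.mpr fun c hci hcj => ?_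
  obtain ⟨u, hu, rfl⟩ := mem_geodesics.mp hci
  obtain ⟨v, hv, he⟩ := mem_geodesics.mp hcj
  obtain ⟨hum, hul⟩ := hA i hi u hu
  obtain ⟨hvm, hvl⟩ := hA j hj v hv
  have := hvm.classLength_cls
  rw [he, hum.classLength_cls, hul, hvl] at this
  exact hij (hlen (by omega))

theorem card_le_mul_card_geodesics {n : ℕ} (hn : 2 ≤ n) {A : Finset (List Bool)}
    (hA : ∀ w ∈ A, PrimWord w ∧ w.length = n) : A.card ≤ n * (geodesics A).card := by
  classical
  refine Finset.card_le_mul_card_image A n ?_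
  intro c hc
  obtain ⟨u, hu, rfl⟩ := Finset.mem_image.mp hc
  obtain ⟨hup, hul⟩ := hA u hu
  calc _ ≤ ((Finset.range n).image fun j => u.rotate j).card := by
        refine Finset.card_le_card fun v hv => ?_
        obtain ⟨hv, he⟩ := Finset.mem_filter.mp hv
        obtain ⟨hvp, hvl⟩ := hA v hv
        obtain ⟨j, rfl⟩ := ((hvp.mixed (by omega)).cls_eq_iff (hup.mixed (by omega))).mp he |>.symm
        exact Finset.mem_image.mpr ⟨j % n, Finset.mem_range.mpr (Nat.mod_lt _ (by omega)), by
          rw [← hul, List.rotate_mod]⟩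
    _ ≤ n := Finset.card_image_le.trans (by simp)

open Classical in
/-- The primitive words of length `n`. -/
def primWords (n : ℕ) : Finset (List Bool) := (words n).filter PrimWord

theorem mem_primWords {n : ℕ} {w : List Bool} :
    w ∈ primWords n ↔ w.length = n ∧ PrimWord w := by simp [primWords]

/-- The fibres of `cls` here are full rotation orbits, and the `n` rotations of a primitive word are
distinct. -/
theorem mul_card_geodesics_primWords {n : ℕ} (hn : 2 ≤ n) :
    n * (geodesics (primWords n)).card = (primWords n).card := by
  classical
  refine le_antisymm ?_ (card_le_mul_card_geodesics hn fun w hw => (mem_primWords.mp hw).symm)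
  refine Finset.mul_card_image_le_card _ n ?_
  intro c hc
  obtain ⟨u, hu, rfl⟩ := Finset.mem_image.mp hc
  obtain ⟨hul, hup⟩ := mem_primWords.mp hu
  have hinj : Set.InjOn (fun j => u.rotate j) (Finset.range n : Finset ℕ) := by
    have key : ∀ i j, i < n → j < n → i ≤ j → u.rotate i = u.rotate j → i = j := by
      intro i j hi hj hij he
      by_contra hne
      refine hup.2 (j - i) (by omega) (by omega) (List.rotate_injective i ?_)
      show (u.rotate (j - i)).rotate i = u.rotate i
      rw [List.rotate_rotate, Nat.sub_add_cancel hij, he]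
    intro i hi j hj he
    have hi' : i < n := by simpa using hi
    have hj' : j < n := by simpa using hj
    rcases le_total i j with h | h
    · exact key i j hi' hj' h he
    · exact (key j i hj' hi' h he.symm).symm
  calc n = ((Finset.range n).image fun j => u.rotate j).card := by
        rw [Finset.card_image_of_injOn hinj, Finset.card_range]
    _ ≤ _ := by
        refine Finset.card_le_card fun v hv => ?_
        obtain ⟨j, -, rfl⟩ := Finset.mem_image.mp hv
        exact Finset.mem_filter.mpr ⟨mem_primWords.mpr ⟨by simp [hul], hup.rotate j⟩,
          (cls_eq_of_isRotated ⟨j, rfl⟩).symm⟩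

theorem two_mul_dvd_iff {k j : ℕ} (hj : j < 2 * k) : 2 * k ∣ 2 * j ↔ j = 0 ∨ j = k := by
  rw [Nat.mul_dvd_mul_iff_left two_pos]
  constructor
  · rintro ⟨c, rfl⟩
    have hk : 0 < k := by omega
    have : c < 2 := by
      by_contra h
      nlinarith
    interval_cases c <;> simp
  · rintro (rfl | rfl) <;> simp

/-- Among the rotations of a primitive self-dual word of length `2 * k`, only those by `0` and `k`
are self-dual. -/
theorem card_le_two_mul_card_geodesics {k : ℕ} (hk : 1 ≤ k) {A : Finset (List Bool)}
    (hA : ∀ w ∈ A, PrimWord w ∧ w.length = 2 * k ∧ dual w = w) :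
    A.card ≤ 2 * (geodesics A).card := by
  classical
  refine Finset.card_le_mul_card_image A 2 ?_
  intro c hc
  obtain ⟨u, hu, rfl⟩ := Finset.mem_image.mp hc
  obtain ⟨hup, hul, hud⟩ := hA u hu
  calc _ ≤ ({u, u.rotate k} : Finset (List Bool)).card := by
        refine Finset.card_le_card fun v hv => ?_
        obtain ⟨hv, he⟩ := Finset.mem_filter.mp hv
        obtain ⟨hvp, hvl, hvd⟩ := hA v hv
        obtain ⟨j, rfl⟩ := ((hvp.mixed (by omega)).cls_eq_iff (hup.mixed (by omega))).mp he |>.symm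
        rw [← List.rotate_mod u j, hul] at hvd ⊢
        rw [hup.dual_rotate_eq_iff hud, hul, two_mul_dvd_iff (Nat.mod_lt _ (by omega))] at hvd
        generalize j % (2 * k) = i at hvd ⊢
        rcases hvd with rfl | rfl <;> simp
    _ ≤ 2 := Finset.card_le_two

open Classical in
/-- The primitive words of length `2 * k` that are fixed by `dual`. -/
def dualWords (k : ℕ) : Finset (List Bool) :=
  ((words k).image fun x => x ++ dual x).filter PrimWord

theorem mem_dualWords {k : ℕ} {w : List Bool} :
    w ∈ dualWords k ↔ w.length = 2 * k ∧ dual w = w ∧ PrimWord w := by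
  simp only [dualWords, Finset.mem_filter, Finset.mem_image, mem_words]
  constructor
  · rintro ⟨⟨x, hx, rfl⟩, hp⟩
    exact ⟨by simp [hx]; omega, dual_append_dual x, hp⟩
  · rintro ⟨hl, hd, hp⟩
    obtain ⟨x, rfl⟩ := exists_eq_append_dual hd
    exact ⟨⟨x, by simp at hl; omega, rfl⟩, hp⟩

theorem two_mul_card_geodesics_dualWords {k : ℕ} (hk : 1 ≤ k) :
    2 * (geodesics (dualWords k)).card = (dualWords k).card := by
  classical
  refine le_antisymm ?_ (card_le_two_mul_card_geodesics hk fun w hw =>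
    have h := mem_dualWords.mp hw; ⟨h.2.2, h.1, h.2.1⟩)
  refine Finset.mul_card_image_le_card _ 2 ?_
  intro c hc
  obtain ⟨u, hu, rfl⟩ := Finset.mem_image.mp hc
  obtain ⟨hul, hud, hup⟩ := mem_dualWords.mp hu
  have hne : u ≠ u.rotate k := (hup.2 k hk (by omega)).symm
  refine (Finset.card_pair hne).symm.trans_le (Finset.card_le_card fun v hv => ?_)
  simp only [Finset.mem_insert, Finset.mem_singleton] at hv
  rcases hv with rfl | rfl
  · exact Finset.mem_filter.mpr ⟨hu, rfl⟩
  · refine Finset.mem_filter.mpr ⟨mem_dualWords.mpr ⟨by simp [hul], ?_, hup.rotate k⟩,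
      (cls_eq_of_isRotated ⟨k, rfl⟩).symm⟩
    rw [hup.dual_rotate_eq_iff hud, hul]

-- The levels start at two: primitive words of length one give parabolic classes.
open Classical in
theorem setOf_closed_eq (t : ℕ) : {c | IsPrimitiveGeodesic c ∧ classLength c ≤ 2 * t} =
    ((Finset.Icc 2 t).biUnion fun n => geodesics (primWords n) : Finset _) := by
  ext c
  simp only [Set.mem_ofPred_eq, Finset.coe_biUnion, Set.mem_iUnion, Finset.mem_coe, mem_geodesics,
    mem_primWords, Finset.mem_Icc, exists_prop]
  constructor
  · rintro ⟨hp, hl⟩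
    obtain ⟨w, hm, rfl, -⟩ := hp.1.exists_word
    have hpw := hm.isPrimitiveGeodesic_cls.mp hp
    rw [hm.classLength_cls] at hl
    refine ⟨w.length, ⟨?_, by omega⟩, w, ⟨rfl, hpw⟩, rfl⟩
    by_contra h
    obtain ⟨x, hx⟩ := List.length_eq_one_iff.mp
      (le_antisymm (by omega) (List.length_pos_iff.mpr hm.ne_nil))
    rw [hx] at hm
    cases x <;> simp [Mixed] at hm
  · rintro ⟨n, ⟨h2, hn⟩, w, ⟨rfl, hp⟩, rfl⟩
    have hm := hp.mixed h2
    exact ⟨hm.isPrimitiveGeodesic_cls.mpr hp, by rw [hm.classLength_cls]; omega⟩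

theorem finite_closed (t : ℕ) :
    {c | IsPrimitiveGeodesic c ∧ classLength c ≤ 2 * t}.Finite := by
  classical
  rw [setOf_closed_eq]
  exact Finset.finite_toSet _

theorem closedCount_eq (t : ℕ) :
    closedCount t = ∑ n ∈ Finset.Icc 2 t, (geodesics (primWords n)).card := by
  classical
  rw [closedCount, setOf_closed_eq, Set.ncard_coe_finset]
  refine card_biUnion_geodesics _ id Function.injective_id _ fun n hn w hw => ?_
  obtain ⟨hl, hp⟩ := mem_primWords.mp hw
  have := (Finset.mem_Icc.mp hn).1
  exact ⟨hp.mixed (by omega), hl⟩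

-- A self-dual word has even length `2 * k`, so its class length is `4 * k`; this produces the bound
-- `t / 2`.
open Classical in
theorem setOf_recip_eq (t : ℕ) :
    {c | IsPrimitiveGeodesic c ∧ IsReciprocal c ∧ classLength c ≤ 2 * t} =
    ((Finset.Icc 1 (t / 2)).biUnion fun k => geodesics (dualWords k) : Finset _) := by
  ext c
  simp only [Set.mem_ofPred_eq, Finset.coe_biUnion, Set.mem_iUnion, Finset.mem_coe, mem_geodesics,
    mem_dualWords, Finset.mem_Icc, exists_prop]
  constructor
  · rintro ⟨hp, hr, hl⟩
    obtain ⟨w, hm, rfl, -⟩ := hp.1.exists_word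
    obtain ⟨w', hw, hd⟩ := hm.isReciprocal_cls.mp hr
    have hm' := hm.of_isRotated hw
    rw [cls_eq_of_isRotated hw] at hp hl ⊢
    have hpw := hm'.isPrimitiveGeodesic_cls.mp hp
    rw [hm'.classLength_cls] at hl
    obtain ⟨x, hx⟩ := exists_eq_append_dual hd
    have hlen : w'.length = 2 * x.length := by rw [hx]; simp; omega
    have hpos := List.length_pos_iff.mpr hm'.ne_nil
    exact ⟨x.length, ⟨by omega, by omega⟩, w', ⟨hlen, hd, hpw⟩, rfl⟩
  · rintro ⟨k, ⟨h1, hk⟩, w, ⟨hl, hd, hp⟩, rfl⟩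
    have hm := hp.mixed (by omega)
    exact ⟨hm.isPrimitiveGeodesic_cls.mpr hp, hm.isReciprocal hd, by
      rw [hm.classLength_cls]; omega⟩

theorem finite_recip (t : ℕ) :
    {c | IsPrimitiveGeodesic c ∧ IsReciprocal c ∧ classLength c ≤ 2 * t}.Finite := by
  classical
  rw [setOf_recip_eq]
  exact Finset.finite_toSet _

theorem recipCount_eq (t : ℕ) :
    recipCount t = ∑ k ∈ Finset.Icc 1 (t / 2), (geodesics (dualWords k)).card := by
  classical
  rw [recipCount, setOf_recip_eq, Set.ncard_coe_finset]
  refine card_biUnion_geodesics _ (fun k => 2 * k) (fun a b h => by simpa using h) _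
    fun n hn w hw => ?_
  obtain ⟨hl, -, hp⟩ := mem_dualWords.mp hw
  have := (Finset.mem_Icc.mp hn).1
  exact ⟨hp.mixed (by omega), hl⟩

theorem closedCountThick_le (m t : ℕ) : closedCountThick m t ≤ closedCount t :=
  Set.ncard_le_ncard (fun _ hc => ⟨hc.1, hc.2.2⟩) (finite_closed t)

theorem recipCountThick_le (m t : ℕ) : recipCountThick m t ≤ recipCount t :=
  Set.ncard_le_ncard (fun _ hc => ⟨hc.1, hc.2.1, hc.2.2.2⟩) (finite_recip t)

/-- Lower bound for the number of geodesics in a thick part by words with bounded runs. -/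
theorem card_runWords_le_closedCountThick {r t : ℕ} (hr : 2 ≤ r) (ht : 3 ≤ t) :
    (runWords r (t - 2)).card ≤ t * closedCountThick (r + 1) t + 2 * 2 ^ (t / 2) := by
  classical
  -- Only geodesics of the maximal length are used. Closing up costs two letters, that is, a bounded
  -- factor.
  set A := (runWords r (t - 2)).image closeUp with hA
  have hcard : A.card = (runWords r (t - 2)).card :=
    Finset.card_image_of_injective _ closeUp_injective
  have hlen : A ⊆ words t := by
    intro w hw
    obtain ⟨x, hx, rfl⟩ := Finset.mem_image.mp hw
    have := (mem_runWords.mp hx).1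
    simp only [mem_words, length_closeUp]
    omega
  have h1 := card_le_card_filter_primWord (by omega) hlen
  have h2 := card_le_mul_card_geodesics (n := t) (A := A.filter PrimWord) (by omega) fun w hw =>
    ⟨(Finset.mem_filter.mp hw).2, mem_words.mp (hlen (Finset.mem_filter.mp hw).1)⟩
  have h3 : (geodesics (A.filter PrimWord)).card ≤ closedCountThick (r + 1) t := by
    rw [← Set.ncard_coe_finset]
    refine Set.ncard_le_ncard (fun c hc => ?_) ?_
    · obtain ⟨w, hw, rfl⟩ := mem_geodesics.mp hc
      obtain ⟨hwA, hp⟩ := Finset.mem_filter.mp hw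
      have hl := mem_words.mp (hlen hwA)
      obtain ⟨x, hx, rfl⟩ := Finset.mem_image.mp hwA
      have hm := hp.mixed (by omega)
      obtain ⟨hxl, hxr⟩ := mem_runWords.mp hx
      refine ⟨hm.isPrimitiveGeodesic_cls.mpr hp, CyclicRunsLE.carrier_subset hm
        (hxr.cyclicRunsLE_closeUp hr (List.length_pos_iff.mp (by omega))), ?_⟩
      rw [hm.classLength_cls, hl]
    · exact (finite_closed t).subset fun c hc => ⟨hc.1, hc.2.2⟩
  have h4 := Nat.mul_le_mul_left t h3
  omega

/-- Unlike `closeUp`, the passage from `x` to `x ++ dual x` needs no extra letters, so no constant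
is lost in the reciprocal case. -/
theorem sum_card_runWords_le_recipCountThick (r t : ℕ) :
    ∑ k ∈ Finset.Icc 1 (t / 2), (runWords r k).card ≤
      2 * recipCountThick (r + 1) t + ∑ k ∈ Finset.Icc 1 (t / 2), 2 * 2 ^ (k / 2) := by
  classical
  set A : ℕ → Finset (List Bool) := fun k => (runWords r k).image fun x => x ++ dual x with hA
  have hcard : ∀ k, (A k).card = (runWords r k).card := fun k =>
    Finset.card_image_of_injective _ append_dual_injective
  have hmem : ∀ k, ∀ w ∈ A k, w.length = 2 * k ∧ dual w = w ∧ CyclicRunsLE r w := by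
    intro k w hw
    obtain ⟨x, hx, rfl⟩ := Finset.mem_image.mp hw
    obtain ⟨hxl, hxr⟩ := mem_runWords.mp hx
    exact ⟨by simp [hxl]; omega, dual_append_dual x, hxr.cyclicRunsLE_append_dual⟩
  have hmix : ∀ k ∈ Finset.Icc 1 (t / 2), ∀ w ∈ (A k).filter PrimWord,
      Mixed w ∧ w.length = 2 * k := by
    intro k hk w hw
    obtain ⟨hwA, hp⟩ := Finset.mem_filter.mp hw
    have hl := (hmem k w hwA).1
    have := (Finset.mem_Icc.mp hk).1
    exact ⟨hp.mixed (by omega), hl⟩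
  have h1 : ∀ k ∈ Finset.Icc 1 (t / 2), (runWords r k).card ≤
      2 * (geodesics ((A k).filter PrimWord)).card + 2 * 2 ^ (k / 2) := by
    intro k hk
    have hk1 := (Finset.mem_Icc.mp hk).1
    have h2 := card_le_card_filter_primWord_of_dual hk1 (A := A k)
      fun w hw => ⟨(hmem k w hw).1, (hmem k w hw).2.1⟩
    have h3 := card_le_two_mul_card_geodesics hk1 (A := (A k).filter PrimWord) fun w hw =>
      have h := hmem k w (Finset.mem_filter.mp hw).1
      ⟨(Finset.mem_filter.mp hw).2, h.1, h.2.1⟩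
    rw [hcard] at h2
    omega
  refine (Finset.sum_le_sum h1).trans ?_
  rw [Finset.sum_add_distrib, ← Finset.mul_sum, ← card_biUnion_geodesics _ (fun k => 2 * k)
    (fun a b h => by simpa using h) (fun k => (A k).filter PrimWord) hmix]
  refine Nat.add_le_add_right (Nat.mul_le_mul_left 2 ?_) _
  rw [← Set.ncard_coe_finset]
  refine Set.ncard_le_ncard (fun c hc => ?_) ?_
  · obtain ⟨k, hk, hc⟩ := Finset.mem_biUnion.mp (Finset.mem_coe.mp hc)
    obtain ⟨w, hw, rfl⟩ := mem_geodesics.mp hc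
    obtain ⟨hm, hl⟩ := hmix k hk w hw
    obtain ⟨hwA, hp⟩ := Finset.mem_filter.mp hw
    obtain ⟨-, hd, hr⟩ := hmem k w hwA
    have := (Finset.mem_Icc.mp hk).2
    exact ⟨hm.isPrimitiveGeodesic_cls.mpr hp, hm.isReciprocal hd,
      CyclicRunsLE.carrier_subset hm hr, by rw [hm.classLength_cls, hl]; omega⟩
  · exact (finite_recip t).subset fun c hc => ⟨hc.1, hc.2.1, hc.2.2.2⟩

theorem card_primWords_le (n : ℕ) : (primWords n).card ≤ 2 ^ n := by
  classical
  rw [← card_words]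
  exact Finset.card_filter_le _ _

theorem le_card_primWords {n : ℕ} (hn : 1 ≤ n) :
    2 ^ n ≤ (primWords n).card + 2 * 2 ^ (n / 2) := by
  have := card_le_card_filter_primWord hn (Finset.Subset.refl (words n))
  rwa [card_words] at this

theorem card_dualWords_le (k : ℕ) : (dualWords k).card ≤ 2 ^ k := by
  classical
  rw [← card_words]
  exact (Finset.card_filter_le _ _).trans Finset.card_image_le

theorem le_card_dualWords {k : ℕ} (hk : 1 ≤ k) :
    2 ^ k ≤ (dualWords k).card + 2 * 2 ^ (k / 2) := by
  classical
  have := card_le_card_filter_primWord_of_dual hk (A := (words k).image fun x => x ++ dual x) (by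
    intro w hw
    obtain ⟨x, hx, rfl⟩ := Finset.mem_image.mp hw
    rw [mem_words] at hx
    exact ⟨by simp [hx]; omega, dual_append_dual x⟩)
  rwa [Finset.card_image_of_injective _ append_dual_injective, card_words] at this

/-! ### Growth rates -/

/-- For every `b < log μ` the factor `C / t` is absorbed by the exponentially growing quotient `(μ /
exp b) ^ t`. -/
theorem le_lowerRate {N : ℕ → ℕ} {C μ : ℝ} (hC : 0 < C) (hμ : 0 < μ)
    (h : ∀ᶠ t : ℕ in atTop, C * (μ ^ t / t) ≤ (N t : ℝ)) :
    ((Real.log μ : ℝ) : EReal) ≤ lowerRate N := by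
  refine le_of_forall_lt_imp_le_of_dense fun c hc => ?_
  obtain ⟨b, hcb, hb⟩ := EReal.lt_iff_exists_real_btwn.mp hc
  refine hcb.le.trans (Eventually.le_expGrowthInf ?_)
  have hb' : Real.exp b < μ := by
    rw [← Real.lt_log_iff_exp_lt hμ]
    exact_mod_cast hb
  have hlim := tendsto_self_mul_const_pow_of_lt_one (r := Real.exp b / μ) (by positivity)
    ((div_lt_one hμ).mpr hb')
  filter_upwards [h, hlim.eventually (ge_mem_nhds hC), eventually_gt_atTop 0] with t h1 h2 h3
  rw [← EReal.coe_natCast, ← EReal.coe_mul, EReal.exp_coe, ← ENNReal.ofReal_natCast]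
  refine ENNReal.ofReal_le_ofReal (le_trans ?_ h1)
  have ht : (0 : ℝ) < t := by exact_mod_cast h3
  rw [mul_comm b, Real.exp_nat_mul]
  rw [div_pow, ← mul_div_assoc, div_le_iff₀ (by positivity)] at h2
  rw [← mul_div_assoc, le_div_iff₀ ht]
  linarith

theorem upperRate_le {N : ℕ → ℕ} {C μ : ℝ} (hμ : 0 < μ)
    (h : ∀ᶠ t : ℕ in atTop, (N t : ℝ) ≤ C * μ ^ t) :
    upperRate N ≤ ((Real.log μ : ℝ) : EReal) := by
  refine le_of_forall_gt_imp_ge_of_dense fun c hc => ?_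
  obtain ⟨b, hb, hcb⟩ := EReal.lt_iff_exists_real_btwn.mp hc
  refine le_trans (Eventually.expGrowthSup_le ?_) hcb.le
  have hb' : μ < Real.exp b := by
    rw [← Real.log_lt_iff_lt_exp hμ]
    exact_mod_cast hb
  have hlim := (tendsto_pow_atTop_nhds_zero_of_lt_one (r := μ / Real.exp b) (by positivity)
    ((div_lt_one (Real.exp_pos b)).mpr hb')).const_mul C
  rw [mul_zero] at hlim
  filter_upwards [h, hlim.eventually (ge_mem_nhds one_pos)] with t h1 h2
  rw [← EReal.coe_natCast, ← EReal.coe_mul, EReal.exp_coe, ← ENNReal.ofReal_natCast]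
  refine ENNReal.ofReal_le_ofReal (h1.trans ?_)
  rw [mul_comm b, Real.exp_nat_mul]
  rwa [div_pow, ← mul_div_assoc, div_le_iff₀ (by positivity), one_mul] at h2

theorem lowerRate_le_upperRate (N : ℕ → ℕ) : lowerRate N ≤ upperRate N :=
  ExpGrowth.expGrowthInf_le_expGrowthSup

theorem upperRate_mono {N N' : ℕ → ℕ} (h : ∀ t, N t ≤ N' t) : upperRate N ≤ upperRate N' :=
  ExpGrowth.expGrowthSup_monotone fun t => by exact_mod_cast h t

theorem two_pow_half_le (k : ℕ) : (2 : ℝ) ^ (k / 2) ≤ (3 / 2) ^ k := by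
  calc (2 : ℝ) ^ (k / 2) ≤ (9 / 4) ^ (k / 2) := by gcongr; norm_num
    _ = (3 / 2) ^ (2 * (k / 2)) := by rw [pow_mul]; norm_num
    _ ≤ (3 / 2) ^ k := pow_le_pow_right₀ (by norm_num) (by omega)

theorem sum_two_pow_half_le (K : ℕ) :
    ∑ k ∈ Finset.Icc 1 K, (2 : ℝ) * 2 ^ (k / 2) ≤ 2 * (K * (3 / 2) ^ K) := by
  calc ∑ k ∈ Finset.Icc 1 K, (2 : ℝ) * 2 ^ (k / 2)
      ≤ ∑ k ∈ Finset.Icc 1 K, (2 : ℝ) * (3 / 2) ^ K := by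
        refine Finset.sum_le_sum fun k hk => ?_
        have := (Finset.mem_Icc.mp hk).2
        refine mul_le_mul_of_nonneg_left ((two_pow_half_le k).trans ?_) two_pos.le
        exact pow_le_pow_right₀ (by norm_num) this
    _ = _ := by
        rw [Finset.sum_const, Nat.card_Icc, nsmul_eq_mul]
        simp
        ring

/-- Uses only `lam ≤ 2`, in the form `lam ^ (K + 1) ≤ 2 * lam ^ K`. The factor two cancels the two
self-dual words per geodesic, so the leading constant is one for every `lam`. -/
theorem two_mul_pow_le_sum {lam : ℝ} (h0 : 0 ≤ lam) (h2 : lam ≤ 2) (K : ℕ) :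
    2 * lam ^ K ≤ ∑ k ∈ Finset.Icc 1 K, lam ^ k + 4 := by
  induction K with
  | zero => norm_num
  | succ K ih =>
    rw [Finset.sum_Icc_succ_top (by omega)]
    have h1 : lam ^ (K + 1) ≤ 2 * lam ^ K := by
      rw [pow_succ']
      exact mul_le_mul_of_nonneg_right h2 (pow_nonneg h0 K)
    linarith

/-! ### Explicit bases for the thick parts -/

/-- The bases of the lower bounds in the thick parts. -/
def base (m : ℕ) : ℝ := if 6 ≤ m then 2 - 1 / ((m : ℝ) - 1) else 0

theorem base_bounds {m : ℕ} (hm : 6 ≤ m) : 9 / 5 ≤ base m ∧ base m ≤ 2 := by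
  have hm' : (6 : ℝ) ≤ m := by exact_mod_cast hm
  rw [base, if_pos hm]
  have h1 : 1 / ((m : ℝ) - 1) ≤ 1 / 5 := one_div_le_one_div_of_le (by norm_num) (by linarith)
  have h2 : 0 ≤ 1 / ((m : ℝ) - 1) := by apply one_div_nonneg.mpr; linarith
  constructor <;> linarith

theorem two_mul_le_pow {r : ℕ} (hr : 5 ≤ r) : 2 * (r : ℝ) ≤ (9 / 5) ^ r := by
  induction r, hr using Nat.le_induction with
  | base => norm_num
  | succ r hr ih =>
    have hr' : (5 : ℝ) ≤ r := by exact_mod_cast hr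
    rw [pow_succ]
    push_cast
    linarith

/-- For `r = m - 1` the difference `2 - base m` is `1 / r`, so the growth condition reads `2 * r ≤
base m ^ r`, which follows from `base m ≥ 9 / 5`. -/
theorem pow_base_le {m : ℕ} (hm : 6 ≤ m) (k : ℕ) :
    base m ^ k ≤ ((runWords (m - 1) k).card : ℝ) := by
  obtain ⟨h1, h2⟩ := base_bounds hm
  refine pow_le_card_runWords (by linarith) h2 ?_ k
  have hr : (5 : ℝ) ≤ ((m - 1 : ℕ) : ℝ) := by exact_mod_cast (by omega : 5 ≤ m - 1)
  have e : 2 - base m = 1 / ((m - 1 : ℕ) : ℝ) := by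
    rw [base, if_pos hm, Nat.cast_sub (by omega)]
    simp
  rw [e, one_div_mul_eq_div, le_div_iff₀ (by linarith)]
  exact (two_mul_le_pow (by omega)).trans (pow_le_pow_left₀ (by norm_num) h1 _)

theorem tendsto_base : Tendsto base atTop (𝓝 2) := by
  have h : Tendsto (fun m : ℕ => 2 - 1 / ((m : ℝ) - 1)) atTop (𝓝 (2 - 0)) := by
    refine tendsto_const_nhds.sub ?_
    simp only [one_div]
    exact tendsto_inv_atTop_zero.comp
      (tendsto_atTop_add_const_right _ (-1) tendsto_natCast_atTop_atTop)
  rw [sub_zero] at h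
  refine h.congr' ?_
  filter_upwards [eventually_ge_atTop 6] with m hm
  rw [base, if_pos hm]

/-! ### Reciprocal geodesics -/

theorem recipCount_le (t : ℕ) : (recipCount t : ℝ) ≤ 2 ^ (t / 2) := by
  have h : 2 * recipCount t ≤ ∑ k ∈ Finset.Icc 1 (t / 2), 2 ^ k := by
    rw [recipCount_eq, Finset.mul_sum]
    refine Finset.sum_le_sum fun k hk => ?_
    rw [two_mul_card_geodesics_dualWords (Finset.mem_Icc.mp hk).1]
    exact card_dualWords_le k
  have h2 : ∑ k ∈ Finset.Icc 1 (t / 2), 2 ^ k ≤ ∑ d ∈ Finset.range (t / 2 + 1), 2 ^ d := by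
    refine Finset.sum_le_sum_of_subset fun k hk => ?_
    have := (Finset.mem_Icc.mp hk).2
    exact Finset.mem_range.mpr (by omega)
  have h3 := sum_two_pow_lt (t / 2)
  have h4 : recipCount t ≤ 2 ^ (t / 2) := by omega
  exact_mod_cast h4

theorem le_recipCount (t : ℕ) :
    (2 : ℝ) ^ (t / 2) - (2 + (t / 2 : ℕ) * (3 / 2) ^ (t / 2)) ≤ recipCount t := by
  have h : ∑ k ∈ Finset.Icc 1 (t / 2), 2 ^ k ≤
      2 * recipCount t + ∑ k ∈ Finset.Icc 1 (t / 2), 2 * 2 ^ (k / 2) := by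
    rw [recipCount_eq, Finset.mul_sum, ← Finset.sum_add_distrib]
    refine Finset.sum_le_sum fun k hk => ?_
    have hk1 := (Finset.mem_Icc.mp hk).1
    rw [two_mul_card_geodesics_dualWords hk1]
    exact le_card_dualWords hk1
  have h' : ∑ k ∈ Finset.Icc 1 (t / 2), (2 : ℝ) ^ k ≤
      2 * recipCount t + ∑ k ∈ Finset.Icc 1 (t / 2), 2 * 2 ^ (k / 2) := by exact_mod_cast h
  have h1 := sum_two_pow_half_le (t / 2)
  have h2 := two_mul_pow_le_sum (lam := 2) (by norm_num) le_rfl (t / 2)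
  linarith

theorem le_recipCountThick {m : ℕ} (hm : 6 ≤ m) (t : ℕ) :
    base m ^ (t / 2) - (2 + (t / 2 : ℕ) * (3 / 2) ^ (t / 2)) ≤ recipCountThick m t := by
  have h := sum_card_runWords_le_recipCountThick (m - 1) t
  rw [Nat.sub_add_cancel (by omega)] at h
  have h' : ∑ k ∈ Finset.Icc 1 (t / 2), ((runWords (m - 1) k).card : ℝ) ≤
      2 * recipCountThick m t + ∑ k ∈ Finset.Icc 1 (t / 2), 2 * 2 ^ (k / 2) := by exact_mod_cast h
  have h0 := Finset.sum_le_sum fun k (_ : k ∈ Finset.Icc 1 (t / 2)) => pow_base_le hm k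
  obtain ⟨hb1, hb2⟩ := base_bounds hm
  have h1 := sum_two_pow_half_le (t / 2)
  have h2 := two_mul_pow_le_sum (by linarith) hb2 (t / 2)
  linarith

/-- Since `9 / 5` is below every `base m` with `6 ≤ m`, comparison with its powers gives a threshold
that serves all `m` at once. -/
theorem eventually_error_le {ε : ℝ} (hε : 0 < ε) :
    ∀ᶠ K : ℕ in atTop, 2 + (K : ℝ) * (3 / 2) ^ K ≤ ε * (9 / 5) ^ K := by
  have h1 := tendsto_self_mul_const_pow_of_lt_one (r := (3 / 2) / (9 / 5)) (by norm_num)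
    (by norm_num)
  have h2 := (tendsto_pow_atTop_nhds_zero_of_lt_one (r := 1 / (9 / 5 : ℝ)) (by norm_num)
    (by norm_num)).const_mul 2
  have h3 := h2.add h1
  rw [mul_zero, add_zero] at h3
  filter_upwards [h3.eventually (ge_mem_nhds hε)] with K hK
  have hpos : (0 : ℝ) < (9 / 5) ^ K := by positivity
  rw [div_pow 1, div_pow (3 / 2), one_pow, ← mul_div_assoc, ← mul_div_assoc, ← add_div, mul_one,
    div_le_iff₀ hpos] at hK
  exact hK

theorem tendsto_half : Tendsto (fun t : ℕ => t / 2) atTop atTop :=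
  Nat.tendsto_div_const_atTop two_ne_zero

theorem recipCount_isEquivalent :
    (fun t : ℕ => (recipCount t : ℝ)) ~[atTop] (fun t : ℕ => (2 : ℝ) ^ (t / 2)) := by
  refine IsLittleO.of_bound fun ε hε => ?_
  filter_upwards [tendsto_half.eventually (eventually_error_le hε)] with t ht
  have h1 := recipCount_le t
  have h2 := le_recipCount t
  have h3 : (9 / 5 : ℝ) ^ (t / 2) ≤ 2 ^ (t / 2) := pow_le_pow_left₀ (by norm_num) (by norm_num) _
  have h4 := mul_le_mul_of_nonneg_left h3 hε.le
  rw [Pi.sub_apply, Real.norm_eq_abs, Real.norm_eq_abs, abs_of_nonpos (by linarith),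
    abs_of_pos (by positivity)]
  linarith

theorem exists_le_recipCountThick {ε : ℝ} (hε : 0 < ε) : ∃ t₀ : ℕ, ∀ m t : ℕ, t₀ ≤ t →
    (1 - ε) * base m ^ (t / 2) ≤ recipCountThick m t := by
  obtain ⟨t₀, ht₀⟩ := eventually_atTop.mp
    ((tendsto_half.eventually (eventually_error_le hε)).and (eventually_ge_atTop 2))
  refine ⟨t₀, fun m t ht => ?_⟩
  obtain ⟨h1, h2⟩ := ht₀ t ht
  by_cases hm : 6 ≤ m
  · have h3 := le_recipCountThick hm t
    have h4 := mul_le_mul_of_nonneg_left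
      (pow_le_pow_left₀ (by norm_num) (base_bounds hm).1 (t / 2)) hε.le
    linarith
  -- For small `m` the base is zero; `2 ≤ t` makes the exponent `t / 2` positive, so the bound is
  -- trivial.
  · rw [base, if_neg hm, zero_pow (by omega), mul_zero]
    exact Nat.cast_nonneg _

/-- Rounding `t / 2` down costs at most a factor `√lam`. -/
theorem le_lowerRate_of_pow_half {N : ℕ → ℕ} {C lam : ℝ} (hC : 0 < C) (hl : 1 ≤ lam)
    (h : ∀ᶠ t : ℕ in atTop, C * lam ^ (t / 2) ≤ (N t : ℝ)) :
    ((Real.log lam / 2 : ℝ) : EReal) ≤ lowerRate N := by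
  rw [← Real.log_sqrt (by linarith)]
  have hs : 1 ≤ √lam := Real.one_le_sqrt.mpr hl
  refine le_lowerRate (C := C / √lam) (by positivity) (by linarith) ?_
  filter_upwards [h, eventually_ge_atTop 1] with t ht ht1
  refine le_trans ?_ ht
  have ht' : (1 : ℝ) ≤ t := by exact_mod_cast ht1
  have h1 : √lam ^ t ≤ √lam * lam ^ (t / 2) := by
    calc √lam ^ t ≤ √lam ^ (2 * (t / 2) + 1) := pow_le_pow_right₀ hs (by omega)
      _ = √lam * lam ^ (t / 2) := by
        rw [pow_succ, pow_mul, Real.sq_sqrt (by linarith), mul_comm]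
  have h2 : √lam ^ t / t ≤ √lam * lam ^ (t / 2) :=
    (div_le_self (by positivity) ht').trans h1
  calc C / √lam * (√lam ^ t / t) ≤ C / √lam * (√lam * lam ^ (t / 2)) := by gcongr
    _ = C * lam ^ (t / 2) := by field_simp

theorem upperRate_recipCount_le : upperRate recipCount ≤ ((Real.log 2 / 2 : ℝ) : EReal) := by
  rw [← Real.log_sqrt (by norm_num)]
  refine upperRate_le (C := 1) (by positivity) (Eventually.of_forall fun t => ?_)
  refine (recipCount_le t).trans ?_
  rw [one_mul]
  calc (2 : ℝ) ^ (t / 2) = √2 ^ (2 * (t / 2)) := by rw [pow_mul, Real.sq_sqrt (by norm_num)]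
    _ ≤ √2 ^ t := pow_le_pow_right₀ (Real.one_le_sqrt.mpr (by norm_num)) (by omega)

theorem le_lowerRate_recipCount : ((Real.log 2 / 2 : ℝ) : EReal) ≤ lowerRate recipCount := by
  refine le_lowerRate_of_pow_half (C := 1 / 2) (by norm_num) (by norm_num) ?_
  filter_upwards [tendsto_half.eventually (eventually_error_le (ε := 1 / 2) (by norm_num))] with t ht
  have h2 := le_recipCount t
  have h3 : (9 / 5 : ℝ) ^ (t / 2) ≤ 2 ^ (t / 2) := pow_le_pow_left₀ (by norm_num) (by norm_num) _
  linarith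

theorem le_lowerRate_recipCountThick {m : ℕ} (hm : 6 ≤ m) :
    ((Real.log (base m) / 2 : ℝ) : EReal) ≤ lowerRate (recipCountThick m) := by
  obtain ⟨t₀, ht₀⟩ := exists_le_recipCountThick (ε := 1 / 2) (by norm_num)
  refine le_lowerRate_of_pow_half (C := 1 / 2) (by norm_num)
    (by linarith [(base_bounds hm).1]) ?_
  filter_upwards [eventually_ge_atTop t₀] with t ht
  have := ht₀ m t ht
  linarith

/-! ### All closed geodesics -/

theorem closedCount_le (t : ℕ) : (closedCount t : ℝ) ≤ 2 * 2 ^ t := by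
  have h : closedCount t ≤ ∑ d ∈ Finset.range (t + 1), 2 ^ d := by
    rw [closedCount_eq]
    calc _ ≤ ∑ n ∈ Finset.Icc 2 t, 2 ^ n := by
          refine Finset.sum_le_sum fun n hn => ?_
          have hn2 := (Finset.mem_Icc.mp hn).1
          have h1 := mul_card_geodesics_primWords hn2
          have h2 := card_primWords_le n
          nlinarith
      _ ≤ _ := by
          refine Finset.sum_le_sum_of_subset fun k hk => ?_
          have := (Finset.mem_Icc.mp hk).2
          exact Finset.mem_range.mpr (by omega)
  have h3 := sum_two_pow_lt t
  have h4 : closedCount t ≤ 2 * 2 ^ t := by omega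
  exact_mod_cast h4

/-- The number of primitive closed geodesics of word length `2 * n`. -/
def levelCount (n : ℕ) : ℝ := if 2 ≤ n then ((geodesics (primWords n)).card : ℝ) else 0

theorem closedCount_eq_sum (t : ℕ) :
    (closedCount t : ℝ) = ∑ n ∈ Finset.range (t + 1), levelCount n := by
  rw [closedCount_eq]
  simp only [levelCount]
  rw [← Finset.sum_filter]
  push_cast
  refine Finset.sum_congr ?_ fun _ _ => rfl
  ext n
  simp only [Finset.mem_Icc, Finset.mem_filter, Finset.mem_range]
  omega

theorem levelCount_isEquivalent : levelCount ~[atTop] fun n : ℕ => (2 : ℝ) ^ n / n := by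
  refine IsLittleO.of_bound fun ε hε => ?_
  filter_upwards [eventually_error_le hε, eventually_ge_atTop 2] with n hn hn2
  have hn0 : (2 : ℝ) ≤ n := by exact_mod_cast hn2
  have h1 : (n : ℝ) * levelCount n = (primWords n).card := by
    rw [levelCount, if_pos hn2]
    exact_mod_cast mul_card_geodesics_primWords hn2
  have h2 : ((primWords n).card : ℝ) ≤ 2 ^ n := by exact_mod_cast card_primWords_le n
  have h3 : (2 : ℝ) ^ n ≤ (primWords n).card + 2 * 2 ^ (n / 2) := by
    exact_mod_cast le_card_primWords (by omega)
  have h4 : (9 / 5 : ℝ) ^ n ≤ 2 ^ n := pow_le_pow_left₀ (by norm_num) (by norm_num) _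
  have h5 := mul_le_mul_of_nonneg_left h4 hε.le
  have h6 := two_pow_half_le n
  have h7 : 2 * (3 / 2 : ℝ) ^ n ≤ n * (3 / 2) ^ n :=
    mul_le_mul_of_nonneg_right hn0 (by positivity)
  have h8 : levelCount n = (primWords n).card / n := by
    rw [← h1]; field_simp
  rw [Pi.sub_apply, Real.norm_eq_abs, Real.norm_eq_abs, h8, ← sub_div, abs_div, abs_div,
    ← mul_div_assoc]
  refine div_le_div_of_nonneg_right ?_ (abs_nonneg _)
  rw [abs_of_nonpos (by linarith), abs_of_pos (by positivity)]
  linarith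

/-- The increments of `2 ^ (n + 1) / n`. -/
def increment (n : ℕ) : ℝ := 2 ^ n * (n - 2) / (n * (n - 1))

/-- The sum telescopes from `n = 3` on, and `4` is the value of `2 ^ (n + 1) / n` at `n = 2`. The
terms at `0` and `1` vanish by the convention for division by zero. -/
theorem sum_increment {t : ℕ} (ht : 2 ≤ t) :
    ∑ n ∈ Finset.range (t + 1), increment n = 2 ^ (t + 1) / t - 4 := by
  induction t, ht using Nat.le_induction with
  | base => norm_num [Finset.sum_range_succ, increment]
  | succ t ht ih =>
    have ht' : (2 : ℝ) ≤ t := by exact_mod_cast ht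
    rw [Finset.sum_range_succ, ih, increment]
    push_cast
    have h1 : (t : ℝ) ≠ 0 := by linarith
    have h2 : (t : ℝ) + 1 ≠ 0 := by linarith
    rw [add_sub_cancel_right]
    field_simp
    ring

theorem increment_isEquivalent : increment ~[atTop] fun n : ℕ => (2 : ℝ) ^ n / n := by
  rw [isEquivalent_iff_tendsto_one]
  · have h : Tendsto (fun n : ℕ => 1 - 1 / ((n : ℝ) - 1)) atTop (𝓝 (1 - 0)) := by
      refine tendsto_const_nhds.sub ?_
      simp only [one_div]
      exact tendsto_inv_atTop_zero.comp
        (tendsto_atTop_add_const_right _ (-1) tendsto_natCast_atTop_atTop)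
    rw [sub_zero] at h
    refine h.congr' ?_
    filter_upwards [eventually_ge_atTop 2] with n hn
    have hn' : (2 : ℝ) ≤ n := by exact_mod_cast hn
    have h1 : (n : ℝ) ≠ 0 := by linarith
    have h2 : (n : ℝ) - 1 ≠ 0 := by linarith
    rw [Pi.div_apply, increment]
    field_simp
    ring
  · filter_upwards [eventually_ge_atTop 1] with n hn
    have : (n : ℝ) ≠ 0 := by positivity
    positivity

theorem tendsto_two_pow_div : Tendsto (fun t : ℕ => (2 : ℝ) ^ (t + 1) / t) atTop atTop := by
  have h := tendsto_pow_const_div_const_pow_of_one_lt 1 (r := (2 : ℝ)) (by norm_num)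
  have h1 : Tendsto (fun t : ℕ => (t : ℝ) / 2 ^ t) atTop (𝓝[>] 0) := by
    refine tendsto_nhdsWithin_iff.mpr ⟨by simpa using h, ?_⟩
    filter_upwards [eventually_gt_atTop 0] with t ht
    have : (0 : ℝ) < t := by exact_mod_cast ht
    exact Set.mem_Ioi.mpr (by positivity)
  refine (h1.inv_tendsto_nhdsGT_zero.const_mul_atTop two_pos).congr fun t => ?_
  rw [Pi.inv_apply, inv_div, pow_succ]
  ring

/-- A Stolz–Cesàro argument: the level counts are equivalent to the nonnegative increments of `2 ^
(t + 1) / t`, whose sum diverges, so the partial sums are equivalent too. -/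
theorem closedCount_isEquivalent :
    (fun t : ℕ => (closedCount t : ℝ)) ~[atTop] (fun t : ℕ => (2 : ℝ) ^ (t + 1) / (t : ℝ)) := by
  have hsum : (fun t : ℕ => ∑ n ∈ Finset.range (t + 1), increment n) =ᶠ[atTop]
      fun t : ℕ => (2 : ℝ) ^ (t + 1) / t - 4 := by
    filter_upwards [eventually_ge_atTop 2] with t ht
    exact sum_increment ht
  have htop : Tendsto (fun t => ∑ n ∈ Finset.range t, increment n) atTop atTop := by
    rw [← tendsto_add_atTop_iff_nat 1]
    exact (tendsto_atTop_add_const_right _ (-4) tendsto_two_pow_div).congr' hsum.symm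
  have hnonneg : ∀ n, 0 ≤ increment n := by
    intro n
    rcases Nat.lt_or_ge n 2 with h | h
    · interval_cases n <;> norm_num [increment]
    · have h' : (2 : ℝ) ≤ n := by exact_mod_cast h
      rw [increment]
      refine div_nonneg (mul_nonneg (by positivity) (by linarith))
        (mul_nonneg (by linarith) (by linarith))
  have h1 : levelCount ~[atTop] increment := levelCount_isEquivalent.trans increment_isEquivalent.symm
  have h2 : (fun t => ∑ n ∈ Finset.range t, levelCount n) ~[atTop]
      fun t => ∑ n ∈ Finset.range t, increment n := by
    have h3 := IsLittleO.sum_range h1.isLittleO hnonneg htop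
    refine h3.congr_left fun t => ?_
    simp [Finset.sum_sub_distrib]
  have h3 := h2.comp_tendsto (tendsto_add_atTop_nat 1)
  have h4 : (fun t : ℕ => (2 : ℝ) ^ (t + 1) / t - 4) ~[atTop] fun t : ℕ => (2 : ℝ) ^ (t + 1) / t := by
    refine ((isLittleO_const_left (c := (4 : ℝ))).mpr (Or.inr ?_)).neg_left.congr_left fun t => ?_
    · exact tendsto_norm_atTop_atTop.comp tendsto_two_pow_div
    · simp
  refine (IsEquivalent.trans ?_ (h3.trans (hsum.isEquivalent.trans h4)))
  exact IsEquivalent.refl.congr_left (Eventually.of_forall fun t => (closedCount_eq_sum t).symm)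

theorem exists_le_closedCountThick : ∃ t₀ : ℕ, ∀ m t : ℕ, t₀ ≤ t →
    1 / 8 * (base m ^ t / (t : ℝ)) ≤ closedCountThick m t := by
  obtain ⟨t₀, ht₀⟩ := eventually_atTop.mp
    ((eventually_error_le (ε := 1 / 8) (by norm_num)).and (eventually_ge_atTop 3))
  refine ⟨t₀, fun m t ht => ?_⟩
  obtain ⟨h1, h2⟩ := ht₀ t ht
  have ht0 : (3 : ℝ) ≤ t := by exact_mod_cast h2
  by_cases hm : 6 ≤ m
  · obtain ⟨hb1, hb2⟩ := base_bounds hm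
    have h3 := card_runWords_le_closedCountThick (r := m - 1) (t := t) (by omega) h2
    rw [Nat.sub_add_cancel (by omega)] at h3
    have h3' : ((runWords (m - 1) (t - 2)).card : ℝ) ≤
        t * closedCountThick m t + 2 * 2 ^ (t / 2) := by exact_mod_cast h3
    have h4 := pow_base_le hm (t - 2)
    -- The two letters lost in closing up cost at most a factor `4`. The nonprimitive words cost at
    -- most `base m ^ t / 8`, and `1 / 4 - 1 / 8 = 1 / 8` remains.
    have h5 : base m ^ t ≤ 4 * base m ^ (t - 2) := by
      obtain ⟨s, rfl⟩ := Nat.exists_eq_add_of_le' (by omega : 2 ≤ t)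
      rw [Nat.add_sub_cancel, pow_add, mul_comm]
      exact mul_le_mul_of_nonneg_right (by nlinarith) (pow_nonneg (by linarith) _)
    have h6 := pow_le_pow_left₀ (by norm_num) hb1 t
    have h7 := two_pow_half_le t
    have h8 : 3 * (3 / 2 : ℝ) ^ t ≤ t * (3 / 2) ^ t :=
      mul_le_mul_of_nonneg_right ht0 (by positivity)
    have h9 : (0 : ℝ) < (3 / 2) ^ t := by positivity
    rw [← mul_div_assoc, div_le_iff₀ (by linarith)]
    linarith
  · rw [base, if_neg hm, zero_pow (by omega), zero_div, mul_zero]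
    exact Nat.cast_nonneg _

theorem upperRate_closedCount_le : upperRate closedCount ≤ ((Real.log 2 : ℝ) : EReal) :=
  upperRate_le (C := 2) (by norm_num) (Eventually.of_forall closedCount_le)

theorem le_lowerRate_closedCountThick {m : ℕ} (hm : 6 ≤ m) :
    ((Real.log (base m) : ℝ) : EReal) ≤ lowerRate (closedCountThick m) := by
  obtain ⟨t₀, ht₀⟩ := exists_le_closedCountThick
  refine le_lowerRate (C := 1 / 8) (by norm_num) (by linarith [(base_bounds hm).1]) ?_
  filter_upwards [eventually_ge_atTop t₀] with t ht
  exact ht₀ m t ht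

theorem le_lowerRate_closedCount : ((Real.log 2 : ℝ) : EReal) ≤ lowerRate closedCount := by
  refine le_lowerRate (C := 1) (by norm_num) (by norm_num) ?_
  have h := (isEquivalent_iff_tendsto_one ?_).mp closedCount_isEquivalent
  · filter_upwards [h.eventually (le_mem_nhds (show (1 / 2 : ℝ) < 1 by norm_num)),
      eventually_gt_atTop 0] with t ht ht0
    have ht' : (0 : ℝ) < t := by exact_mod_cast ht0
    rw [Pi.div_apply, le_div_iff₀ (by positivity), pow_succ] at ht
    refine le_trans (le_of_eq ?_) ht
    ring
  · filter_upwards [eventually_gt_atTop 0] with t ht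
    have ht' : (0 : ℝ) < t := by exact_mod_cast ht
    positivity

/-- Convergence of growth rates by comparison. -/
theorem tendsto_rates {N : ℕ → ℕ} {Nm : ℕ → ℕ → ℕ} {a : ℝ} {am : ℕ → ℝ}
    (hle : ∀ m t, Nm m t ≤ N t) (hu : upperRate N ≤ a) (hl : (a : EReal) ≤ lowerRate N)
    (ham : Tendsto am atTop (𝓝 a)) (hm : ∀ᶠ m in atTop, (am m : EReal) ≤ lowerRate (Nm m)) :
    lowerRate N = a ∧ upperRate N = a ∧
      Tendsto (fun m => lowerRate (Nm m)) atTop (𝓝 (lowerRate N)) ∧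
      Tendsto (fun m => upperRate (Nm m)) atTop (𝓝 (upperRate N)) := by
  have e1 : lowerRate N = a := le_antisymm ((lowerRate_le_upperRate N).trans hu) hl
  have e2 : upperRate N = a := le_antisymm hu (hl.trans (lowerRate_le_upperRate N))
  have hu' : ∀ m, upperRate (Nm m) ≤ a := fun m => (upperRate_mono (hle m)).trans hu
  have ham' : Tendsto (fun m => (am m : EReal)) atTop (𝓝 (a : EReal)) :=
    (continuous_coe_real_ereal.tendsto a).comp ham
  refine ⟨e1, e2, ?_, ?_⟩
  · rw [e1]
    exact tendsto_of_tendsto_of_tendsto_of_le_of_le' ham' tendsto_const_nhds hm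
      (Eventually.of_forall fun m => (lowerRate_le_upperRate _).trans (hu' m))
  · rw [e2]
    exact tendsto_of_tendsto_of_tendsto_of_le_of_le' ham' tendsto_const_nhds
      (hm.mono fun m h => h.trans (lowerRate_le_upperRate _)) (Eventually.of_forall hu')

end ModularOrbifold

end

open ModularOrbifold in
theorem mainTheorem2 :
    -- all primitive reciprocal geodesics: `2 ^ ⌊t / 2⌋`
    ((fun t : ℕ => (recipCount t : ℝ)) ~[atTop] (fun t : ℕ => (2 : ℝ) ^ (t / 2))) ∧
    lowerRate recipCount = ((Real.log 2 / 2 : ℝ) : EReal) ∧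
    upperRate recipCount = ((Real.log 2 / 2 : ℝ) : EReal) ∧
    -- primitive reciprocal geodesics in the thick parts
    (∃ c lam : ℕ → ℝ, Tendsto c atTop (𝓝 1) ∧ Tendsto lam atTop (𝓝 2) ∧
      ∀ ε : ℝ, 0 < ε → ∃ t₀ : ℕ, ∀ m : ℕ, 1 ≤ m → ∀ t : ℕ, t₀ ≤ t →
        (1 - ε) * (c m * lam m ^ (t / 2)) ≤ (recipCountThick m t : ℝ) ∧
        recipCountThick m t ≤ recipCount t) ∧
    Tendsto (fun m : ℕ => lowerRate (recipCountThick m)) atTop (𝓝 (lowerRate recipCount)) ∧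
    Tendsto (fun m : ℕ => upperRate (recipCountThick m)) atTop (𝓝 (upperRate recipCount)) ∧
    -- all primitive closed geodesics: `2 ^ (t + 1) / t`
    ((fun t : ℕ => (closedCount t : ℝ)) ~[atTop] (fun t : ℕ => (2 : ℝ) ^ (t + 1) / (t : ℝ))) ∧
    lowerRate closedCount = ((Real.log 2 : ℝ) : EReal) ∧
    upperRate closedCount = ((Real.log 2 : ℝ) : EReal) ∧
    -- primitive closed geodesics in the thick parts
    (∃ C : ℝ, 0 < C ∧ ∃ lam : ℕ → ℝ, Tendsto lam atTop (𝓝 2) ∧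
      ∃ t₀ : ℕ, ∀ m : ℕ, 1 ≤ m → ∀ t : ℕ, t₀ ≤ t →
        C * (lam m ^ t / (t : ℝ)) ≤ (closedCountThick m t : ℝ) ∧
        closedCountThick m t ≤ closedCount t) ∧
    Tendsto (fun m : ℕ => lowerRate (closedCountThick m)) atTop (𝓝 (lowerRate closedCount)) ∧
    Tendsto (fun m : ℕ => upperRate (closedCountThick m)) atTop (𝓝 (upperRate closedCount)) := by
  have hlog : Tendsto (fun m => Real.log (base m)) atTop (𝓝 (Real.log 2)) :=
    (Real.continuousAt_log two_ne_zero).tendsto.comp tendsto_base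
  obtain ⟨r1, r2, r3, r4⟩ := tendsto_rates recipCountThick_le upperRate_recipCount_le
    le_lowerRate_recipCount (hlog.div_const 2)
    ((eventually_ge_atTop 6).mono fun _ hm => le_lowerRate_recipCountThick hm)
  obtain ⟨w1, w2, w3, w4⟩ := tendsto_rates closedCountThick_le upperRate_closedCount_le
    le_lowerRate_closedCount hlog
    ((eventually_ge_atTop 6).mono fun _ hm => le_lowerRate_closedCountThick hm)
  -- The constant sequence `1` serves as `c`, and `base` as `lam` in both parts.
  refine ⟨recipCount_isEquivalent, r1, r2,
    ⟨fun _ => 1, base, tendsto_const_nhds, tendsto_base, fun ε hε => ?_⟩, r3, r4,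
    closedCount_isEquivalent, w1, w2, ⟨1 / 8, by norm_num, base, tendsto_base, ?_⟩, w3, w4⟩
  · obtain ⟨t₀, ht₀⟩ := exists_le_recipCountThick hε
    exact ⟨t₀, fun m _ t ht => ⟨by rw [one_mul]; exact ht₀ m t ht, recipCountThick_le m t⟩⟩
  · obtain ⟨t₀, ht₀⟩ := exists_le_closedCountThick
    exact ⟨t₀, fun m _ t ht => ⟨ht₀ m t ht, closedCountThick_le m t⟩⟩
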